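/- Let $E=\{0,1,\dots,n-1\}$, let $\{A_i\}_{i\in E}$ be real $d\times d$ matrices, and let $Q$ be an irreducible generator ($Q$-matrix) on $E$ with unique invariant probability vector $\pi$, i.e. $\pi Q=0$. Put $\bar A=\sum_{i\in E}\pi_iA_i$. For $r>0$ let $(I^{(r)}_t)_{t\ge 0}$ be the continuous-time Markov process on $E$ (with right-continuous paths) that has generator $rQ$ and initial law $\nu$, and let $S^{(r)}_t$ be the random linear operator on $\mathbb{R}^d$ that maps $X_0$ to $X_t$, where $X$ is the solution of $$X_t=X_0+\int_0^tA_{I^{(r)}_s}X_s\,ds,\qquad t\ge 0.$$ Let $\|\cdot\|$ be the operator norm for the Euclidean norm on $\mathbb{R}^d$, and let $\mathbb{E}_\nu$ be the expectation when $I^{(r)}_0$ has law $\nu$. Then for every probability measure $\nu$ on $E$ and every $t>0$, $\|S^{(r)}_t\|$ is integrable for every $r>0$, and $$\mathbb{E}_\nu\|S^{(r)}_t\|\longrightarrow\|\exp(\bar At)\|\qquad\text{as } r\to\infty.$$ -/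

import Mathlib

open MeasureTheory Filter Topology Set

namespace SwitchedODE

/-- `Q` is an irreducible generator (`Q`-matrix) on the finite state space `{0, …, n-1}`:
nonnegative off-diagonal rates, zero row sums, and every state can be reached from every other
state through jumps with positive rates. -/
structure IsIrreducibleGenerator {n : ℕ} (Q : Matrix (Fin n) (Fin n) ℝ) : Prop where
  offDiag_nonneg : ∀ i j, i ≠ j → 0 ≤ Q i j
  row_sum : ∀ i, ∑ j, Q i j = 0
  irreducible : ∀ i j, Relation.ReflTransGen (fun a b => 0 < Q a b) i j

/-- `p` is an invariant probability vector of the generator `Q`: `p Q = 0`. -/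
structure IsInvariantProbability {n : ℕ} (Q : Matrix (Fin n) (Fin n) ℝ) (p : Fin n → ℝ) :
    Prop where
  nonneg : ∀ i, 0 ≤ p i
  sum_eq_one : ∑ i, p i = 1
  vecMul_eq_zero : Matrix.vecMul p Q = 0

/-- `(I t)_{t ≥ 0}` is a continuous time Markov process on `{0, …, n-1}` with generator `G` and
initial law `ν`: it has right-continuous paths almost surely, and its finite dimensional
distributions are those given by the initial law `ν` and the transition matrices `exp (t G)`.
Times are real numbers; only the values `I t` with `0 ≤ t` matter. -/
structure IsMarkovProcess {n : ℕ} {Ω : Type*} [MeasurableSpace Ω] (P : Measure Ω)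
    (I : ℝ → Ω → Fin n) (G : Matrix (Fin n) (Fin n) ℝ) (ν : Measure (Fin n)) : Prop where
  measurable : ∀ t, 0 ≤ t → Measurable (I t)
  right_continuous : ∀ᵐ ω ∂P, ∀ t, 0 ≤ t → ContinuousWithinAt (fun s => I s ω) (Ici t) t
  finite_dim : ∀ (m : ℕ) (t : Fin (m + 1) → ℝ) (i : Fin (m + 1) → Fin n),
    t 0 = 0 → Monotone t →
      P.real {ω | ∀ k, I (t k) ω = i k} =
        ν.real {i 0} * ∏ k : Fin m,
          (NormedSpace.exp ((t k.succ - t k.castSucc) • G)) (i k.castSucc) (i k.succ)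

/-- The operator on the Euclidean space `ℝᵈ` given by a `d × d` matrix. The norm of such an
operator is the operator norm for the Euclidean norm. -/
noncomputable abbrev op {d : ℕ} (M : Matrix (Fin d) (Fin d) ℝ) :
    EuclideanSpace ℝ (Fin d) →L[ℝ] EuclideanSpace ℝ (Fin d) :=
  Matrix.toEuclideanCLM (𝕜 := ℝ) (n := Fin d) M

/-- `X` solves the switched equation `X t = X 0 + ∫ s in 0..t, A_{i s} X s` on `t ≥ 0`, along the
path `i` of the switching process. -/
structure IsSolution {n d : ℕ} (A : Fin n → Matrix (Fin d) (Fin d) ℝ) (i : ℝ → Fin n)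
    (X : ℝ → EuclideanSpace ℝ (Fin d)) : Prop where
  continuousOn : ContinuousOn X (Ici 0)
  integral_eq : ∀ t, 0 ≤ t → X t = X 0 + ∫ s in (0 : ℝ)..t, op (A (i s)) (X s)

/-- `S t` maps every initial value `x` to the value at time `t` of a solution started at `x`. -/
def IsSolutionOperator {n d : ℕ} (A : Fin n → Matrix (Fin d) (Fin d) ℝ) (i : ℝ → Fin n)
    (S : ℝ → EuclideanSpace ℝ (Fin d) →L[ℝ] EuclideanSpace ℝ (Fin d)) : Prop :=
  ∀ x, S 0 x = x ∧ IsSolution A i (fun t => S t x)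

open Classical in
/-- The solution operator `X 0 ↦ X t` of the switched equation along the path `i`. By
`isSolutionOperator_solutionOperator` and `solutionOperator_apply` below it is the solution
operator along every right-continuous path (the value for other paths is irrelevant). -/
noncomputable def solutionOperator {n d : ℕ} (A : Fin n → Matrix (Fin d) (Fin d) ℝ)
    (i : ℝ → Fin n) : ℝ → EuclideanSpace ℝ (Fin d) →L[ℝ] EuclideanSpace ℝ (Fin d) :=
  if h : ∃ S, IsSolutionOperator A i S then h.choose else 0

/-- The average matrix `∑ i, p i • A i`. -/
noncomputable def averageMatrix {n d : ℕ} (A : Fin n → Matrix (Fin d) (Fin d) ℝ)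
    (p : Fin n → ℝ) : Matrix (Fin d) (Fin d) ℝ :=
  ∑ i, p i • A i

theorem measurable_path {n : ℕ} {i : ℝ → Fin n}
    (hi : ∀ t, 0 ≤ t → ContinuousWithinAt i (Ici t) t) :
    Measurable (fun s => i (max s 0)) := by
  have key : ∀ N : ℕ, Measurable
      (fun s : ℝ => i (((⌊((N : ℝ) + 1) * max s 0⌋₊ : ℝ) + 1) / ((N : ℝ) + 1))) := by
    intro N
    have h1 : Measurable (fun s : ℝ => ⌊((N : ℝ) + 1) * max s 0⌋₊) :=
      Nat.measurable_floor.comp (by fun_prop)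
    exact (measurable_from_nat (f := fun k : ℕ => i (((k : ℝ) + 1) / ((N : ℝ) + 1)))).comp h1
  refine measurable_of_tendsto_metrizable key ?_
  rw [tendsto_pi_nhds]
  intro s
  have hs : (0 : ℝ) ≤ max s 0 := le_max_right _ _
  refine (hi _ hs).tendsto.comp (tendsto_nhdsWithin_iff.2 ⟨?_, ?_⟩)
  · have hlim : Tendsto (fun N : ℕ => max s 0 + 1 / ((N : ℝ) + 1)) atTop (𝓝 (max s 0)) := by
      simpa using tendsto_const_nhds.add (tendsto_one_div_add_atTop_nhds_zero_nat (𝕜 := ℝ))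
    refine tendsto_of_tendsto_of_tendsto_of_le_of_le tendsto_const_nhds hlim ?_ ?_
    · intro N
      have hN : (0 : ℝ) < (N : ℝ) + 1 := by positivity
      have := (Nat.lt_floor_add_one (((N : ℝ) + 1) * max s 0)).le
      simp only
      rw [le_div_iff₀ hN]
      linarith
    · intro N
      have hN : (0 : ℝ) < (N : ℝ) + 1 := by positivity
      have := Nat.floor_le (mul_nonneg hN.le hs)
      simp only
      have e : (max s 0 + 1 / ((N : ℝ) + 1)) * ((N : ℝ) + 1) = ((N : ℝ) + 1) * max s 0 + 1 := by
        field_simp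
      rw [div_le_iff₀ hN, e]
      linarith
  · refine Eventually.of_forall fun N => ?_
    have hN : (0 : ℝ) < (N : ℝ) + 1 := by positivity
    have := (Nat.lt_floor_add_one (((N : ℝ) + 1) * max s 0)).le
    rw [mem_Ici, le_div_iff₀ hN]
    linarith

/-- The coefficient `s ↦ A_{i s}` of the equation, extended to the left of zero. -/
noncomputable def coeff {n d : ℕ} (A : Fin n → Matrix (Fin d) (Fin d) ℝ) (i : ℝ → Fin n) (s : ℝ) :
    EuclideanSpace ℝ (Fin d) →L[ℝ] EuclideanSpace ℝ (Fin d) :=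
  op (A (i (max s 0)))

/-- The terms of the Picard iteration for the operator equation. -/
noncomputable def picardTerm {n d : ℕ} (A : Fin n → Matrix (Fin d) (Fin d) ℝ) (i : ℝ → Fin n) :
    ℕ → ℝ → EuclideanSpace ℝ (Fin d) →L[ℝ] EuclideanSpace ℝ (Fin d)
  | 0 => fun _ => 1
  | k + 1 => fun t => ∫ s in (0 : ℝ)..t, coeff A i s * picardTerm A i k s

section WellPosed

variable {n d : ℕ} {A : Fin n → Matrix (Fin d) (Fin d) ℝ} {i : ℝ → Fin n}

theorem norm_coeff_le (s : ℝ) : ‖coeff A i s‖ ≤ ∑ j, ‖op (A j)‖ :=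
  Finset.single_le_sum (f := fun j => ‖op (A j)‖) (fun _ _ => norm_nonneg _) (Finset.mem_univ _)

theorem stronglyMeasurable_coeff (hi : ∀ t, 0 ≤ t → ContinuousWithinAt i (Ici t) t) :
    StronglyMeasurable (coeff A i) :=
  ((measurable_of_finite (fun j : Fin n => op (A j))).comp (measurable_path hi)).stronglyMeasurable

theorem integrable_coeff_mul (hi : ∀ t, 0 ≤ t → ContinuousWithinAt i (Ici t) t)
    {F : ℝ → EuclideanSpace ℝ (Fin d) →L[ℝ] EuclideanSpace ℝ (Fin d)} (hF : Continuous F)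
    (a b : ℝ) : IntervalIntegrable (fun s => coeff A i s * F s) volume a b := by
  have h : IntervalIntegrable (fun s => (∑ j, ‖op (A j)‖) * ‖F s‖) volume a b :=
    (continuous_const.mul hF.norm).intervalIntegrable a b
  refine h.mono_fun
    (((stronglyMeasurable_coeff hi).mul hF.stronglyMeasurable).aestronglyMeasurable) ?_
  refine Eventually.of_forall fun s => ?_
  refine (norm_mul_le _ _).trans (le_trans ?_ (le_abs_self _))
  exact mul_le_mul_of_nonneg_right (norm_coeff_le s) (norm_nonneg _)

theorem continuous_picardTerm (hi : ∀ t, 0 ≤ t → ContinuousWithinAt i (Ici t) t) (k : ℕ) :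
    Continuous (picardTerm A i k) := by
  induction k with
  | zero => exact continuous_const
  | succ k ih => exact intervalIntegral.continuous_primitive (integrable_coeff_mul hi ih) 0

theorem norm_picardTerm_le (k : ℕ) :
    ∀ t, 0 ≤ t → ‖picardTerm A i k t‖ ≤ ((∑ j, ‖op (A j)‖) * t) ^ k / (k.factorial : ℝ) := by
  set K := ∑ j, ‖op (A j)‖ with hK
  have hK0 : 0 ≤ K := Finset.sum_nonneg fun _ _ => norm_nonneg _
  induction k with
  | zero =>
    intro t _
    simp only [picardTerm, pow_zero, Nat.factorial_zero, Nat.cast_one, div_one]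
    exact ContinuousLinearMap.norm_id_le
  | succ k ih =>
    intro t ht
    have h1 : ‖picardTerm A i (k + 1) t‖ ≤
        ∫ s in (0 : ℝ)..t, K * ((K * s) ^ k / (k.factorial : ℝ)) := by
      refine intervalIntegral.norm_integral_le_of_norm_le ht (Eventually.of_forall fun s hs => ?_)
        (by apply Continuous.intervalIntegrable; fun_prop)
      exact (norm_mul_le _ _).trans
        (mul_le_mul (norm_coeff_le s) (ih s hs.1.le) (norm_nonneg _) hK0)
    refine h1.trans (le_of_eq ?_)
    have h2 : ∀ s : ℝ, K * ((K * s) ^ k / (k.factorial : ℝ))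
        = K ^ (k + 1) / (k.factorial : ℝ) * s ^ k := by
      intro s; rw [mul_pow]; ring
    simp only [h2]
    rw [intervalIntegral.integral_const_mul, integral_pow, Nat.factorial_succ]
    have : (k.factorial : ℝ) ≠ 0 := by positivity
    push_cast
    field_simp
    ring

theorem exists_isSolutionOperator (hi : ∀ t, 0 ≤ t → ContinuousWithinAt i (Ici t) t) :
    ∃ S, IsSolutionOperator A i S := by
  set K := ∑ j, ‖op (A j)‖ with hK
  have hK0 : 0 ≤ K := Finset.sum_nonneg fun _ _ => norm_nonneg _
  have hbd : ∀ T : ℝ, ∀ k, ∀ t ∈ Icc (0 : ℝ) T,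
      ‖picardTerm A i k t‖ ≤ (K * T) ^ k / (k.factorial : ℝ) := by
    intro T k t ht
    refine (norm_picardTerm_le k t ht.1).trans ?_
    have : K * t ≤ K * T := mul_le_mul_of_nonneg_left ht.2 hK0
    have h0 : 0 ≤ K * t := mul_nonneg hK0 ht.1
    gcongr
  have hsum : ∀ t, 0 ≤ t → Summable fun k => picardTerm A i k t := fun t ht =>
    Summable.of_norm_bounded (Real.summable_pow_div_factorial (K * t))
      fun k => hbd t k t ⟨ht, le_rfl⟩
  let S : ℝ → EuclideanSpace ℝ (Fin d) →L[ℝ] EuclideanSpace ℝ (Fin d) :=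
    fun t => ∑' k, picardTerm A i k t
  have hcontT : ∀ T : ℝ, ContinuousOn S (Icc 0 T) := fun T =>
    continuousOn_tsum (fun k => (continuous_picardTerm hi k).continuousOn)
      (Real.summable_pow_div_factorial (K * T)) (fun k t ht => hbd T k t ht)
  have hcont : ContinuousOn S (Ici 0) := by
    intro t ht
    have h := hcontT (t + 1) t ⟨ht, by linarith⟩
    refine h.mono_of_mem_nhdsWithin ?_
    have : Iio (t + 1) ∈ 𝓝 t := Iio_mem_nhds (by linarith)
    filter_upwards [self_mem_nhdsWithin, mem_nhdsWithin_of_mem_nhds this] with s hs hs'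
    exact ⟨hs, le_of_lt hs'⟩
  have hint : ∀ t, 0 ≤ t → S t = 1 + ∫ s in (0 : ℝ)..t, coeff A i s * S s := by
    intro t ht
    have h1 : HasSum (fun k => ∫ s in (0 : ℝ)..t, coeff A i s * picardTerm A i k s)
        (∫ s in (0 : ℝ)..t, coeff A i s * S s) := by
      refine intervalIntegral.hasSum_integral_of_dominated_convergence
        (fun k _ => K * ((K * t) ^ k / (k.factorial : ℝ))) ?_ ?_ ?_ ?_ ?_
      · intro k
        exact ((stronglyMeasurable_coeff hi).mul
          (continuous_picardTerm hi k).stronglyMeasurable).aestronglyMeasurable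
      · intro k
        refine Eventually.of_forall fun s hs => ?_
        rw [uIoc_of_le ht] at hs
        exact (norm_mul_le _ _).trans
          (mul_le_mul (norm_coeff_le s) (hbd t k s ⟨hs.1.le, hs.2⟩) (norm_nonneg _) hK0)
      · exact Eventually.of_forall fun s _ =>
          (Real.summable_pow_div_factorial (K * t)).mul_left K
      · exact intervalIntegrable_const
      · refine Eventually.of_forall fun s hs => ?_
        rw [uIoc_of_le ht] at hs
        exact (hsum s hs.1.le).hasSum.mul_left _
    rw [← h1.tsum_eq]
    exact (hsum t ht).tsum_eq_zero_add
  refine ⟨S, fun x => ?_⟩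
  have hS0 : S 0 = 1 := by simpa using hint 0 le_rfl
  refine ⟨by simp [hS0], ⟨hcont.clm_apply continuousOn_const, fun t ht => ?_⟩⟩
  have hI : IntervalIntegrable (fun s => coeff A i s * S s) volume 0 t := by
    have h : IntervalIntegrable (fun s => K * ‖S s‖) volume 0 t :=
      (continuousOn_const.mul ((hcontT t).mono (by rw [uIcc_of_le ht])).norm).intervalIntegrable
    have hm : AEStronglyMeasurable S (volume.restrict (uIoc 0 t)) :=
      ((hcontT t).mono (by rw [uIoc_of_le ht]; exact Ioc_subset_Icc_self)).aestronglyMeasurable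
        measurableSet_uIoc
    refine h.mono_fun ((stronglyMeasurable_coeff hi).aestronglyMeasurable.mul hm) ?_
    refine Eventually.of_forall fun s => ?_
    refine (norm_mul_le _ _).trans (le_trans ?_ (le_abs_self _))
    exact mul_le_mul_of_nonneg_right (norm_coeff_le s) (norm_nonneg _)
  have h2 := congrArg (fun L => L x) (hint t ht)
  simp only [add_apply] at h2
  rw [ContinuousLinearMap.intervalIntegral_apply hI] at h2
  rw [h2, hS0]
  congr 1
  refine intervalIntegral.integral_congr fun s hs => ?_
  rw [uIcc_of_le ht] at hs
  simp [coeff, max_eq_left hs.1]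

theorem isSolutionOperator_solutionOperator
    (hi : ∀ t, 0 ≤ t → ContinuousWithinAt i (Ici t) t) :
    IsSolutionOperator A i (solutionOperator A i) := by
  have h := exists_isSolutionOperator (A := A) hi
  rw [solutionOperator, dif_pos h]
  exact h.choose_spec

theorem isSolution_unique (hi : ∀ t, 0 ≤ t → ContinuousWithinAt i (Ici t) t)
    {X Y : ℝ → EuclideanSpace ℝ (Fin d)} (hX : IsSolution A i X) (hY : IsSolution A i Y)
    (h0 : X 0 = Y 0) {t : ℝ} (ht : 0 ≤ t) : X t = Y t := by
  set K := ∑ j, ‖op (A j)‖ with hK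
  have hK0 : 0 ≤ K := Finset.sum_nonneg fun _ _ => norm_nonneg _
  have hint : ∀ Z : ℝ → EuclideanSpace ℝ (Fin d), IsSolution A i Z → ∀ u, 0 ≤ u →
      IntervalIntegrable (fun s => op (A (i s)) (Z s)) volume 0 u := by
    intro Z hZ u hu
    have hc : ContinuousOn Z (uIcc 0 u) :=
      hZ.continuousOn.mono (by rw [uIcc_of_le hu]; exact Icc_subset_Ici_self)
    have h : IntervalIntegrable (fun s => K * ‖Z s‖) volume 0 u :=
      (continuousOn_const.mul hc.norm).intervalIntegrable
    have hm : AEStronglyMeasurable Z (volume.restrict (uIoc 0 u)) :=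
      (hc.mono uIoc_subset_uIcc).aestronglyMeasurable measurableSet_uIoc
    have hm2 : AEStronglyMeasurable (fun s => coeff A i s (Z s)) (volume.restrict (uIoc 0 u)) :=
      ContinuousLinearMap.aestronglyMeasurable_comp₂
        (ContinuousLinearMap.id ℝ
          (EuclideanSpace ℝ (Fin d) →L[ℝ] EuclideanSpace ℝ (Fin d)))
        (stronglyMeasurable_coeff hi).aestronglyMeasurable hm
    have h3 : IntervalIntegrable (fun s => coeff A i s (Z s)) volume 0 u := by
      refine h.mono_fun hm2 (Eventually.of_forall fun s => ?_)
      refine ((coeff A i s).le_opNorm _).trans (le_trans ?_ (le_abs_self _))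
      exact mul_le_mul_of_nonneg_right (norm_coeff_le s) (norm_nonneg _)
    refine h3.congr fun s hs => ?_
    rw [uIoc_of_le hu] at hs
    simp [coeff, max_eq_left hs.1.le]
  have hcD : ContinuousOn (fun s => ‖X s - Y s‖) (Ici 0) :=
    (hX.continuousOn.sub hY.continuousOn).norm
  have hbound : ∀ u, 0 ≤ u → ‖X u - Y u‖ ≤ K * ∫ s in (0 : ℝ)..u, ‖X s - Y s‖ := by
    intro u hu
    have e : X u - Y u = ∫ s in (0 : ℝ)..u, op (A (i s)) (X s - Y s) := by
      rw [hX.integral_eq u hu, hY.integral_eq u hu, h0, add_sub_add_left_eq_sub,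
        ← intervalIntegral.integral_sub (hint X hX u hu) (hint Y hY u hu)]
      simp only [map_sub]
    rw [e, ← intervalIntegral.integral_const_mul]
    refine intervalIntegral.norm_integral_le_of_norm_le hu (Eventually.of_forall fun s hs => ?_) ?_
    · refine ((op (A (i s))).le_opNorm _).trans (mul_le_mul_of_nonneg_right ?_ (norm_nonneg _))
      exact Finset.single_le_sum (f := fun j => ‖op (A j)‖) (fun _ _ => norm_nonneg _)
        (Finset.mem_univ (i s))
    · exact (continuousOn_const.mul (hcD.mono
        (by rw [uIcc_of_le hu]; exact Icc_subset_Ici_self))).intervalIntegrable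
  have hcg : Continuous fun s : ℝ => ‖X (max s 0) - Y (max s 0)‖ :=
    hcD.comp_continuous (by fun_prop) (fun s => le_max_right s 0)
  have heq : ∀ u, 0 ≤ u →
      ∫ s in (0 : ℝ)..u, ‖X s - Y s‖ = ∫ s in (0 : ℝ)..u, ‖X (max s 0) - Y (max s 0)‖ := by
    intro u hu
    refine intervalIntegral.integral_congr fun s hs => ?_
    rw [uIcc_of_le hu] at hs
    simp [max_eq_left hs.1]
  have hder : ∀ u : ℝ, HasDerivAt (fun v => ∫ s in (0 : ℝ)..v, ‖X (max s 0) - Y (max s 0)‖)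
      ‖X (max u 0) - Y (max u 0)‖ u := fun u =>
    intervalIntegral.integral_hasDerivAt_right (hcg.intervalIntegrable _ _)
      (hcg.stronglyMeasurableAtFilter _ _) hcg.continuousAt
  have hg := norm_le_gronwallBound_of_norm_deriv_right_le
    (f := fun v => ∫ s in (0 : ℝ)..v, ‖X (max s 0) - Y (max s 0)‖)
    (f' := fun u => ‖X (max u 0) - Y (max u 0)‖) (δ := 0) (K := K) (ε := 0) (a := 0) (b := t)
    (fun u _ => (hder u).continuousAt.continuousWithinAt)
    (fun u _ => (hder u).hasDerivWithinAt) (by simp)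
    (by
      intro u hu
      have h := hbound u hu.1
      rw [heq u hu.1] at h
      rw [norm_norm, max_eq_left hu.1, add_zero]
      exact h.trans (mul_le_mul_of_nonneg_left (le_abs_self _) hK0))
    t ⟨ht, le_rfl⟩
  rw [gronwallBound_ε0_δ0] at hg
  have h := hbound t ht
  rw [heq t ht, norm_le_zero_iff.1 hg, mul_zero] at h
  exact sub_eq_zero.1 (norm_le_zero_iff.1 h)

/-- Along a right-continuous path, the solution operator maps `X 0` to `X t` for every solution. -/
theorem solutionOperator_apply (hi : ∀ t, 0 ≤ t → ContinuousWithinAt i (Ici t) t)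
    {X : ℝ → EuclideanSpace ℝ (Fin d)} (hX : IsSolution A i X) {t : ℝ} (ht : 0 ≤ t) :
    solutionOperator A i t (X 0) = X t :=
  have h := isSolutionOperator_solutionOperator (A := A) hi (X 0)
  isSolution_unique hi h.2 hX h.1 ht

end WellPosed

end SwitchedODE

/-! The argument separates a pathwise estimate from a variance bound, and it gives the rate `C /
√r`.

Pathwise, write B for the averaged operator, c_s for the coefficient along the path, and W_s for the
integral of c - B over [0, s]. Fast switching does not make c - B small, but it makes W small by
cancellation. Integrating by parts in Duhamel's formula (`solutionOperatorExt_sub_exp`) leaves W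
undifferentiated, so the distance from S_t to exp(tB) is at most a constant times |W_t| + ∫₀ᵗ |W_s|
ds, with a constant that depends neither on the path nor on r
(`exists_norm_solutionOperator_sub_exp_le`).

W is a combination of scalar functionals Z_s = ∫₀ˢ f(I_u) du with f of mean zero under the invariant
law. By the maximum principle the Poisson equation Q g = f is solvable (`exists_mulVec_eq`), and g /
r solves it for the generator rQ. In E Z_s² = 2 ∫₀ˢ E[f(I_u) ∫_u^s f(I_v) dv] du, conditioning on
I_u makes the inner integral telescope to boundary terms of size at most 2‖g‖ / r, because
transition matrices are contractions. Hence E Z_s² = O(1/r) and E|Z_s| = O(1/√r), with no spectral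
gap or mixing rate. Taking expectations in the pathwise estimate finishes the proof. -/

namespace SwitchedODE

/-! ### Calculus along one right-continuous path: scalar additive functionals. -/

section Paths

variable {n d : ℕ} {A : Fin n → Matrix (Fin d) (Fin d) ℝ} {i : ℝ → Fin n}

/-- The additive functional `∫₀ˢ f (i u) du` of a path `i`. -/
noncomputable def pathIntegral {n : ℕ} (f : Fin n → ℝ) (i : ℝ → Fin n) (s : ℝ) : ℝ :=
  ∫ u in (0 : ℝ)..s, f (i (max u 0))

theorem continuousWithinAt_comp_path {V : Type*} [TopologicalSpace V] (f : Fin n → V)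
    (hi : ∀ t, 0 ≤ t → ContinuousWithinAt i (Ici t) t) {s : ℝ} (hs : 0 ≤ s) :
    ContinuousWithinAt (fun u => f (i (max u 0))) (Ici s) s := by
  have h : ContinuousWithinAt (fun u => f (i u)) (Ici s) s :=
    (continuous_of_discreteTopology (f := f)).continuousAt.comp_continuousWithinAt (hi s hs)
  refine h.congr (fun u hu => ?_) ?_
  · rw [max_eq_left (hs.trans hu)]
  · rw [max_eq_left hs]

theorem measurable_comp_path {V : Type*} [MeasurableSpace V] (f : Fin n → V)
    (hi : ∀ t, 0 ≤ t → ContinuousWithinAt i (Ici t) t) :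
    Measurable (fun u => f (i (max u 0))) :=
  (measurable_of_finite f).comp (measurable_path hi)

theorem abs_le_sum_abs (f : Fin n → ℝ) (j : Fin n) : |f j| ≤ ∑ k, |f k| :=
  Finset.single_le_sum (f := fun j => |f j|) (fun _ _ => abs_nonneg _) (Finset.mem_univ _)

theorem intervalIntegrable_comp_path (f : Fin n → ℝ)
    (hi : ∀ t, 0 ≤ t → ContinuousWithinAt i (Ici t) t) (a b : ℝ) :
    IntervalIntegrable (fun u => f (i (max u 0))) volume a b := by
  refine (intervalIntegrable_const (c := ∑ k, |f k|)).mono_fun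
    (measurable_comp_path f hi).aestronglyMeasurable (Eventually.of_forall fun s => ?_)
  exact (abs_le_sum_abs f _).trans (le_abs_self _)

theorem continuous_pathIntegral (f : Fin n → ℝ)
    (hi : ∀ t, 0 ≤ t → ContinuousWithinAt i (Ici t) t) : Continuous (pathIntegral f i) :=
  intervalIntegral.continuous_primitive (intervalIntegrable_comp_path f hi) 0

/-- Paths jump, so primitives along them have only right derivatives at jump times; these suffice
for the fundamental theorem of calculus and for Grönwall's inequality. -/
theorem hasDerivWithinAt_primitive {V : Type*} [NormedAddCommGroup V] [NormedSpace ℝ V]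
    [CompleteSpace V] {g : ℝ → V} (hg : ∀ a b, IntervalIntegrable g volume a b)
    (hm : StronglyMeasurable g) {s : ℝ} (hs : ContinuousWithinAt g (Ici s) s) :
    HasDerivWithinAt (fun u => ∫ x in (0 : ℝ)..u, g x) (g s) (Ici s) s :=
  intervalIntegral.integral_hasDerivWithinAt_right (hg 0 s)
    (hm.stronglyMeasurableAtFilter) (hs.mono Ioi_subset_Ici_self)

theorem hasDerivWithinAt_pathIntegral (f : Fin n → ℝ)
    (hi : ∀ t, 0 ≤ t → ContinuousWithinAt i (Ici t) t) {s : ℝ} (hs : 0 ≤ s) :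
    HasDerivWithinAt (pathIntegral f i) (f (i (max s 0))) (Ici s) s :=
  hasDerivWithinAt_primitive (intervalIntegrable_comp_path f hi)
    (measurable_comp_path f hi).stronglyMeasurable (continuousWithinAt_comp_path f hi hs)

theorem abs_pathIntegral_le (f : Fin n → ℝ) (i : ℝ → Fin n) {s : ℝ} (hs : 0 ≤ s) :
    |pathIntegral f i s| ≤ (∑ k, |f k|) * s := by
  have := intervalIntegral.norm_integral_le_of_norm_le_const
    (f := fun u => f (i (max u 0))) (a := 0) (b := s) (C := ∑ k, |f k|)
    (fun u _ => abs_le_sum_abs f _)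
  simpa [pathIntegral, abs_of_nonneg hs] using this

/-- The square of an additive functional as a double integral over ordered pairs of times. -/
theorem sq_pathIntegral (f : Fin n → ℝ)
    (hi : ∀ t, 0 ≤ t → ContinuousWithinAt i (Ici t) t) {s : ℝ} (hs : 0 ≤ s) :
    pathIntegral f i s ^ 2 =
      ∫ u in (0 : ℝ)..s, 2 * (f (i (max u 0)) * ∫ v in u..s, f (i (max v 0))) := by
  have hc := continuous_pathIntegral f hi
  -- With Z the additive functional, -(Z_s - Z_u)² runs from -Z_s² to 0, and its right derivative in
  -- u is the integrand. This replaces symmetrizing a double integral.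
  have h := intervalIntegral.integral_eq_sub_of_hasDeriv_right_of_le hs
    (f := fun u => -(pathIntegral f i s - pathIntegral f i u) ^ 2)
    (f' := fun u => 2 * (f (i (max u 0)) * ∫ v in u..s, f (i (max v 0))))
    (by fun_prop)
    (fun u hu => by
      have h1 := (hasDerivWithinAt_pathIntegral f hi hu.1.le).mono Ioi_subset_Ici_self
      have h2 := ((h1.const_sub (pathIntegral f i s)).pow 2).neg
      refine h2.congr_deriv ?_
      have e : ∫ v in u..s, f (i (max v 0)) = pathIntegral f i s - pathIntegral f i u :=
        (intervalIntegral.integral_interval_sub_left (intervalIntegrable_comp_path f hi _ _)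
          (intervalIntegrable_comp_path f hi _ _)).symm
      rw [e]
      simp
      ring)
    (by
      have e : ∀ u, ∫ v in u..s, f (i (max v 0)) = pathIntegral f i s - pathIntegral f i u :=
        fun u => (intervalIntegral.integral_interval_sub_left
          (intervalIntegrable_comp_path f hi _ _) (intervalIntegrable_comp_path f hi _ _)).symm
      simp only [e]
      exact ((intervalIntegrable_comp_path f hi 0 s).mul_continuousOn
        (by fun_prop : Continuous fun u => pathIntegral f i s - pathIntegral f i u).continuousOn
        ).const_mul 2)
  rw [h]
  simp [pathIntegral]

/-! ### The solution operator as a function of time. -/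

theorem continuousWithinAt_coeff (hi : ∀ t, 0 ≤ t → ContinuousWithinAt i (Ici t) t) {s : ℝ}
    (hs : 0 ≤ s) : ContinuousWithinAt (coeff A i) (Ici s) s :=
  continuousWithinAt_comp_path (fun j => op (A j)) hi hs

/-- The solution operator, extended to negative times by the identity. -/
noncomputable def solutionOperatorExt {n d : ℕ} (A : Fin n → Matrix (Fin d) (Fin d) ℝ)
    (i : ℝ → Fin n) (t : ℝ) : EuclideanSpace ℝ (Fin d) →L[ℝ] EuclideanSpace ℝ (Fin d) :=
  solutionOperator A i (max t 0)

theorem solutionOperatorExt_of_nonneg {t : ℝ} (ht : 0 ≤ t) :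
    solutionOperatorExt A i t = solutionOperator A i t := by
  rw [solutionOperatorExt, max_eq_left ht]

theorem continuous_solutionOperatorExt (hi : ∀ t, 0 ≤ t → ContinuousWithinAt i (Ici t) t) :
    Continuous (solutionOperatorExt A i) := by
  have h : ContinuousOn (solutionOperator A i) (Ici 0) := continuousOn_clm_apply.2 fun x =>
    (isSolutionOperator_solutionOperator (A := A) hi x).2.continuousOn
  exact h.comp_continuous (by fun_prop) fun s => le_max_right s 0

theorem solutionOperatorExt_eq_integral (hi : ∀ t, 0 ≤ t → ContinuousWithinAt i (Ici t) t) {t : ℝ}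
    (ht : 0 ≤ t) : solutionOperatorExt A i t =
      1 + ∫ s in (0 : ℝ)..t, coeff A i s * solutionOperatorExt A i s := by
  ext1 x
  obtain ⟨h0, hs⟩ := isSolutionOperator_solutionOperator (A := A) hi x
  have h1 := hs.integral_eq t ht
  rw [h0] at h1
  rw [solutionOperatorExt_of_nonneg ht, h1, add_apply, ContinuousLinearMap.intervalIntegral_apply
    (integrable_coeff_mul hi (continuous_solutionOperatorExt hi) 0 t)]
  simp only [one_apply_eq_self]
  congr 1
  refine intervalIntegral.integral_congr fun s hs => ?_
  rw [uIcc_of_le ht] at hs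
  simp [coeff, solutionOperatorExt, max_eq_left hs.1]

theorem solutionOperatorExt_zero (hi : ∀ t, 0 ≤ t → ContinuousWithinAt i (Ici t) t) :
    solutionOperatorExt A i 0 = 1 := by
  simpa using solutionOperatorExt_eq_integral (A := A) hi le_rfl

theorem hasDerivWithinAt_solutionOperatorExt
    (hi : ∀ t, 0 ≤ t → ContinuousWithinAt i (Ici t) t) {s : ℝ} (hs : 0 ≤ s) :
    HasDerivWithinAt (solutionOperatorExt A i) (coeff A i s * solutionOperatorExt A i s)
      (Ici s) s := by
  have hc := continuous_solutionOperatorExt (A := A) hi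
  have h := (hasDerivWithinAt_primitive
    (g := fun s => coeff A i s * solutionOperatorExt A i s) (integrable_coeff_mul hi hc)
    ((stronglyMeasurable_coeff hi).mul hc.stronglyMeasurable)
    ((continuousWithinAt_coeff hi hs).mul hc.continuousWithinAt)).const_add 1
  exact h.congr (fun u hu => solutionOperatorExt_eq_integral hi (hs.trans hu))
    (solutionOperatorExt_eq_integral hi hs)

/-- Grönwall's inequality. The bound is the same for all paths, so it serves for integrability over
any probability space. -/
theorem norm_solutionOperatorExt_le (hi : ∀ t, 0 ≤ t → ContinuousWithinAt i (Ici t) t) {s : ℝ}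
    (hs : 0 ≤ s) : ‖solutionOperatorExt A i s‖ ≤ Real.exp ((∑ j, ‖op (A j)‖) * s) := by
  have h := norm_le_gronwallBound_of_norm_deriv_right_le (f := solutionOperatorExt A i)
    (f' := fun s => coeff A i s * solutionOperatorExt A i s) (δ := 1) (K := ∑ j, ‖op (A j)‖)
    (ε := 0) (a := 0) (b := s) (continuous_solutionOperatorExt hi).continuousOn
    (fun u hu => hasDerivWithinAt_solutionOperatorExt hi hu.1)
    (by rw [solutionOperatorExt_zero hi]; exact ContinuousLinearMap.norm_id_le)
    (fun u _ => by
      rw [add_zero]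
      exact (norm_mul_le _ _).trans
        (mul_le_mul_of_nonneg_right (norm_coeff_le u) (norm_nonneg _)))
    s ⟨hs, le_rfl⟩
  rwa [gronwallBound_ε0, sub_zero, one_mul] at h

/-! ### Integrated fluctuations and Duhamel's formula. -/

/-- The integrated fluctuation `∫₀ˢ (A_{i u} - ∑ⱼ pⱼ Aⱼ) du` of the coefficient. -/
noncomputable def fluctuation {n d : ℕ} (A : Fin n → Matrix (Fin d) (Fin d) ℝ) (p : Fin n → ℝ)
    (i : ℝ → Fin n) (s : ℝ) : EuclideanSpace ℝ (Fin d) →L[ℝ] EuclideanSpace ℝ (Fin d) :=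
  ∑ j, pathIntegral (fun k => (if k = j then 1 else 0) - p j) i s • op (A j)

theorem continuous_fluctuation (p : Fin n → ℝ)
    (hi : ∀ t, 0 ≤ t → ContinuousWithinAt i (Ici t) t) : Continuous (fluctuation A p i) :=
  continuous_finsetSum _ fun _ _ => (continuous_pathIntegral _ hi).smul continuous_const

/-- Since ∑ⱼ (1_{k=j} - pⱼ) Aⱼ is A_k minus the average, the operator-valued fluctuation reduces to
finitely many centred scalar functionals. -/
theorem hasDerivWithinAt_fluctuation (p : Fin n → ℝ)
    (hi : ∀ t, 0 ≤ t → ContinuousWithinAt i (Ici t) t) {s : ℝ} (hs : 0 ≤ s) :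
    HasDerivWithinAt (fluctuation A p i) (coeff A i s - op (averageMatrix A p)) (Ici s) s := by
  have h := HasDerivWithinAt.fun_sum (u := Finset.univ) fun j _ =>
    (hasDerivWithinAt_pathIntegral (fun k => (if k = j then 1 else 0) - p j) hi hs).smul_const
      (op (A j))
  refine h.congr_deriv ?_
  ext1 x
  simp only [coeff, averageMatrix, op, map_sum, map_smul]
  ext1 k
  simp [sub_mul, ite_mul, Finset.sum_sub_distrib]

/-- The product rule for E(1 - W)S when E' = -EB, W' = c - B and S' = cS: all terms free of W
cancel. -/
theorem duhamel_derivative_identity {R : Type*} [Ring R] (E B W c S : R) :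
    -(E * B) * ((1 - W) * S) + E * (-(c - B) * S + (1 - W) * (c * S)) =
      E * ((B * W - W * c) * S) := by
  noncomm_ring

/-- Separates a continuous term from one containing the coefficient c, which is merely bounded and
measurable. -/
theorem duhamel_integrand_identity {R : Type*} [Ring R] (E B W c S : R) :
    E * (B * W * S) - E * W * (c * S) = E * ((B * W - W * c) * S) := by
  noncomm_ring

/-- Duhamel's formula for the distance of the solution operator from the averaged flow. -/
theorem solutionOperatorExt_sub_exp (p : Fin n → ℝ)
    (hi : ∀ t, 0 ≤ t → ContinuousWithinAt i (Ici t) t) {t : ℝ} (ht : 0 ≤ t) :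
    solutionOperatorExt A i t - NormedSpace.exp (t • op (averageMatrix A p)) =
      fluctuation A p i t * solutionOperatorExt A i t +
      ∫ s in (0 : ℝ)..t, NormedSpace.exp ((t - s) • op (averageMatrix A p)) *
        ((op (averageMatrix A p) * fluctuation A p i s - fluctuation A p i s * coeff A i s) *
          solutionOperatorExt A i s) := by
  set B := op (averageMatrix A p) with hB
  have hS := continuous_solutionOperatorExt (A := A) hi
  have hW := continuous_fluctuation (A := A) p hi
  have hE : ∀ s : ℝ, HasDerivAt (fun s : ℝ => NormedSpace.exp ((t - s) • B))
      (-(NormedSpace.exp ((t - s) • B) * B)) s := by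
    intro s
    have := (hasDerivAt_exp_smul_const (𝕂 := ℝ) B (t - s)).scomp s
      ((hasDerivAt_id s).const_sub t)
    simpa [Function.comp_def] using this
  have hEc : Continuous (fun s : ℝ => NormedSpace.exp ((t - s) • B)) :=
    continuous_iff_continuousAt.2 fun s => (hE s).continuousAt
  -- Without the corrector 1 - W the derivative would contain c - B, which is not small. The
  -- corrected product runs from exp(tB) at s = 0 to (1 - W_t) S_t at s = t.
  have h := intervalIntegral.integral_eq_sub_of_hasDeriv_right_of_le ht
    (f := fun s => NormedSpace.exp ((t - s) • B) *
      ((1 - fluctuation A p i s) * solutionOperatorExt A i s))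
    (f' := fun s => NormedSpace.exp ((t - s) • B) *
        ((B * fluctuation A p i s - fluctuation A p i s * coeff A i s) *
          solutionOperatorExt A i s))
    (by fun_prop)
    (fun s hs => by
      have h1 := (((hasDerivWithinAt_fluctuation (A := A) p hi hs.1.le).const_sub 1).mul
        (hasDerivWithinAt_solutionOperatorExt (A := A) hi hs.1.le))
      have h2 := ((hE s).hasDerivWithinAt (s := Ici s)).mul h1
      refine (h2.mono Ioi_subset_Ici_self).congr_deriv ?_
      exact duhamel_derivative_identity _ B _ _ _)
    (by
      have h1 : IntervalIntegrable (fun s => NormedSpace.exp ((t - s) • B) *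
          (B * fluctuation A p i s * solutionOperatorExt A i s)) volume 0 t := by
        apply Continuous.intervalIntegrable
        fun_prop
      have h2 := (integrable_coeff_mul (A := A) hi hS 0 t).continuousOn_mul
        (hEc.mul hW).continuousOn
      refine (h1.sub h2).congr fun s _ => ?_
      exact duhamel_integrand_identity _ B _ _ _)
  rw [h, solutionOperatorExt_zero hi]
  have h0 : fluctuation A p i 0 = 0 := by ext1; simp [fluctuation, pathIntegral]
  have h1 : (0 : ℝ) • B = 0 := by ext1; simp
  simp only [sub_self, h1, NormedSpace.exp_zero, h0, sub_zero, mul_one, one_mul, sub_mul]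
  abel

/-- The weighted size of the fluctuations, which bounds the norm of `fluctuation`. -/
noncomputable def fluctuationBound {n d : ℕ} (A : Fin n → Matrix (Fin d) (Fin d) ℝ)
    (p : Fin n → ℝ) (i : ℝ → Fin n) (s : ℝ) : ℝ :=
  ∑ j, |pathIntegral (fun k => (if k = j then 1 else 0) - p j) i s| * ‖op (A j)‖

theorem norm_fluctuation_le (p : Fin n → ℝ) (s : ℝ) :
    ‖fluctuation A p i s‖ ≤ fluctuationBound A p i s :=
  (norm_sum_le _ _).trans (Finset.sum_le_sum fun j _ => by rw [norm_smul, Real.norm_eq_abs])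

theorem fluctuationBound_nonneg (p : Fin n → ℝ) (s : ℝ) : 0 ≤ fluctuationBound A p i s :=
  Finset.sum_nonneg fun _ _ => mul_nonneg (abs_nonneg _) (norm_nonneg _)

theorem continuous_fluctuationBound (p : Fin n → ℝ)
    (hi : ∀ t, 0 ≤ t → ContinuousWithinAt i (Ici t) t) : Continuous (fluctuationBound A p i) :=
  continuous_finsetSum _ fun _ _ => (continuous_pathIntegral _ hi).abs.mul continuous_const

/-- The constant is chosen before the path, so the estimate can be averaged over any law and is
uniform in the switching rate. -/
theorem exists_norm_solutionOperator_sub_exp_le (A : Fin n → Matrix (Fin d) (Fin d) ℝ)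
    (p : Fin n → ℝ) {t : ℝ} (ht : 0 ≤ t) :
    ∃ C, 0 ≤ C ∧ ∀ i : ℝ → Fin n, (∀ t, 0 ≤ t → ContinuousWithinAt i (Ici t) t) →
      ‖solutionOperator A i t - NormedSpace.exp (t • op (averageMatrix A p))‖ ≤
        C * (fluctuationBound A p i t + ∫ s in (0 : ℝ)..t, fluctuationBound A p i s) := by
  set B := op (averageMatrix A p) with hB
  set K := ∑ j, ‖op (A j)‖ with hK
  have hK0 : 0 ≤ K := Finset.sum_nonneg fun _ _ => norm_nonneg _
  have hEc : Continuous (fun s : ℝ => NormedSpace.exp ((t - s) • B)) :=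
    (continuous_iff_continuousAt.2 fun s =>
      (hasDerivAt_exp_smul_const (𝕂 := ℝ) B s).continuousAt).comp
        (continuous_const.sub continuous_id)
  obtain ⟨M, hM⟩ := (isCompact_Icc (a := (0 : ℝ)) (b := t)).exists_bound_of_continuousOn
    hEc.continuousOn
  have hM0 : 0 ≤ M := (norm_nonneg _).trans (hM 0 ⟨le_rfl, ht⟩)
  set L := Real.exp (K * t) with hL
  have hL0 : 0 ≤ L := (Real.exp_pos _).le
  have hC0 : 0 ≤ M * ((‖B‖ + K) * L) := by positivity
  -- L handles the boundary term of Duhamel's formula, the product handles its integral; their sum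
  -- dominates both.
  refine ⟨L + M * ((‖B‖ + K) * L), by positivity, fun i hi => ?_⟩
  have hSL : ∀ s ∈ Icc (0 : ℝ) t, ‖solutionOperatorExt A i s‖ ≤ L := fun s hs =>
    (norm_solutionOperatorExt_le hi hs.1).trans
      (Real.exp_le_exp.2 (mul_le_mul_of_nonneg_left hs.2 hK0))
  have hw := continuous_fluctuationBound (A := A) p hi
  rw [← solutionOperatorExt_of_nonneg ht, solutionOperatorExt_sub_exp p hi ht]
  have h1 : ‖fluctuation A p i t * solutionOperatorExt A i t‖ ≤ L * fluctuationBound A p i t := by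
    rw [mul_comm L]
    exact (norm_mul_le _ _).trans (mul_le_mul (norm_fluctuation_le p t) (hSL t ⟨ht, le_rfl⟩)
      (norm_nonneg _) (fluctuationBound_nonneg p t))
  have h2 : ‖∫ s in (0 : ℝ)..t, NormedSpace.exp ((t - s) • B) *
        ((B * fluctuation A p i s - fluctuation A p i s * coeff A i s) *
          solutionOperatorExt A i s)‖ ≤
      ∫ s in (0 : ℝ)..t, M * ((‖B‖ + K) * L) * fluctuationBound A p i s := by
    refine intervalIntegral.norm_integral_le_of_norm_le ht (Eventually.of_forall fun s hs => ?_)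
      ((continuous_const.mul hw).intervalIntegrable _ _)
    have hs' : s ∈ Icc (0 : ℝ) t := ⟨hs.1.le, hs.2⟩
    have hWs := norm_fluctuation_le (A := A) (i := i) p s
    have hb := fluctuationBound_nonneg (A := A) (i := i) p s
    have h3 : ‖B * fluctuation A p i s - fluctuation A p i s * coeff A i s‖ ≤
        (‖B‖ + K) * fluctuationBound A p i s := by
      refine (norm_sub_le _ _).trans ?_
      rw [add_mul]
      refine add_le_add ((norm_mul_le _ _).trans
        (mul_le_mul_of_nonneg_left hWs (norm_nonneg _))) ((norm_mul_le _ _).trans ?_)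
      rw [mul_comm K]
      exact mul_le_mul hWs (norm_coeff_le s) (norm_nonneg _) hb
    calc _ ≤ M * (((‖B‖ + K) * fluctuationBound A p i s) * L) := by
            refine (norm_mul_le _ _).trans (mul_le_mul (hM s hs') ?_ (norm_nonneg _) hM0)
            exact (norm_mul_le _ _).trans (mul_le_mul h3 (hSL s hs') (norm_nonneg _)
              (by positivity))
      _ = _ := by ring
  rw [intervalIntegral.integral_const_mul] at h2
  have h4 : 0 ≤ ∫ s in (0 : ℝ)..t, fluctuationBound A p i s :=
    intervalIntegral.integral_nonneg ht fun s _ => fluctuationBound_nonneg p s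
  have h5 := fluctuationBound_nonneg (A := A) (i := i) p t
  refine (norm_add_le _ _).trans ((add_le_add h1 h2).trans ?_)
  nlinarith [mul_nonneg hL0 h4, mul_nonneg hC0 h5]

/-! ### Convergence of the Picard iterates. -/

/-- The Picard iterates for the solution operator. -/
noncomputable def picardSum {n d : ℕ} (A : Fin n → Matrix (Fin d) (Fin d) ℝ) (i : ℝ → Fin n)
    (N : ℕ) (t : ℝ) : EuclideanSpace ℝ (Fin d) →L[ℝ] EuclideanSpace ℝ (Fin d) :=
  ∑ k ∈ Finset.range N, picardTerm A i k t

theorem picardSum_succ (hi : ∀ t, 0 ≤ t → ContinuousWithinAt i (Ici t) t) (N : ℕ) (t : ℝ) :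
    picardSum A i (N + 1) t = 1 + ∫ s in (0 : ℝ)..t, coeff A i s * picardSum A i N s := by
  simp only [picardSum, Finset.mul_sum]
  rw [intervalIntegral.integral_finsetSum fun k _ =>
    integrable_coeff_mul hi (continuous_picardTerm hi k) 0 t, Finset.sum_range_succ', add_comm]
  rfl

/-- The error obeys e_{N+1}(t) = ∫₀ᵗ c e_N, so each integration contributes a factor Kt / (N + 1),
starting from the Grönwall bound. The horizon T is fixed so that the exponential stays constant
under the integral. -/
theorem norm_solutionOperatorExt_sub_picardSum_le
    (hi : ∀ t, 0 ≤ t → ContinuousWithinAt i (Ici t) t) (T : ℝ) (N : ℕ) :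
    ∀ t ∈ Icc (0 : ℝ) T, ‖solutionOperatorExt A i t - picardSum A i N t‖ ≤
      Real.exp ((∑ j, ‖op (A j)‖) * T) * (((∑ j, ‖op (A j)‖) * t) ^ N / (N.factorial : ℝ)) := by
  set K := ∑ j, ‖op (A j)‖ with hK
  have hK0 : 0 ≤ K := Finset.sum_nonneg fun _ _ => norm_nonneg _
  induction N with
  | zero =>
    intro t ht
    simpa [picardSum] using (norm_solutionOperatorExt_le (A := A) hi ht.1).trans
      (Real.exp_le_exp.2 (mul_le_mul_of_nonneg_left ht.2 hK0))
  | succ N ih =>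
    intro t ht
    have hP : Continuous (picardSum A i N) :=
      continuous_finsetSum _ fun k _ => continuous_picardTerm hi k
    rw [solutionOperatorExt_eq_integral hi ht.1, picardSum_succ hi, add_sub_add_left_eq_sub,
      ← intervalIntegral.integral_sub
        (integrable_coeff_mul hi (continuous_solutionOperatorExt hi) 0 t)
        (integrable_coeff_mul hi hP 0 t)]
    have h1 : ‖∫ s in (0 : ℝ)..t, (coeff A i s * solutionOperatorExt A i s -
        coeff A i s * picardSum A i N s)‖ ≤
        ∫ s in (0 : ℝ)..t, K * (Real.exp (K * T) * ((K * s) ^ N / (N.factorial : ℝ))) := by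
      refine intervalIntegral.norm_integral_le_of_norm_le ht.1
        (Eventually.of_forall fun s hs => ?_) (by apply Continuous.intervalIntegrable; fun_prop)
      rw [← mul_sub]
      exact (norm_mul_le _ _).trans (mul_le_mul (norm_coeff_le s)
        (ih s ⟨hs.1.le, hs.2.trans ht.2⟩) (norm_nonneg _) hK0)
    refine h1.trans (le_of_eq ?_)
    have h2 : ∀ s : ℝ, K * (Real.exp (K * T) * ((K * s) ^ N / (N.factorial : ℝ)))
        = Real.exp (K * T) * K ^ (N + 1) / (N.factorial : ℝ) * s ^ N := by
      intro s; rw [mul_pow]; ring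
    simp only [h2]
    rw [intervalIntegral.integral_const_mul, integral_pow, Nat.factorial_succ]
    have : (N.factorial : ℝ) ≠ 0 := by positivity
    push_cast
    field_simp
    ring

/-- `solutionOperator` comes from a choice made path by path, which says nothing about measurability
in ω; this limit of explicit iterates supplies it. -/
theorem tendsto_picardSum (hi : ∀ t, 0 ≤ t → ContinuousWithinAt i (Ici t) t) {t : ℝ}
    (ht : 0 ≤ t) :
    Tendsto (fun N => picardSum A i N t) atTop (𝓝 (solutionOperator A i t)) := by
  rw [← solutionOperatorExt_of_nonneg ht, tendsto_iff_norm_sub_tendsto_zero]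
  have h := (FloorSemiring.tendsto_pow_div_factorial_atTop
    ((∑ j, ‖op (A j)‖) * t)).const_mul (Real.exp ((∑ j, ‖op (A j)‖) * t))
  rw [mul_zero] at h
  refine squeeze_zero (fun _ => norm_nonneg _) (fun N => ?_) h
  rw [norm_sub_rev]
  exact norm_solutionOperatorExt_sub_picardSum_le hi t N t ⟨ht, le_rfl⟩

end Paths

/-! ### Transition matrices, the maximum principle and the Poisson equation. -/

section Generator

/-- Grönwall's inequality for e^{cs} exp(sx), whose derivative is x + c times itself. The shift can
make the exponent ‖x + c‖ - c nonpositive, which ‖x‖ alone cannot do unless x = 0. -/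
theorem norm_exp_smul_le {𝔸 : Type*} [NormedRing 𝔸] [NormedAlgebra ℝ 𝔸] [CompleteSpace 𝔸]
    [NormOneClass 𝔸] (x : 𝔸) (c : ℝ) {τ : ℝ} (hτ : 0 ≤ τ) :
    ‖NormedSpace.exp (τ • x)‖ ≤ Real.exp ((‖x + c • (1 : 𝔸)‖ - c) * τ) := by
  have hd : ∀ s : ℝ, HasDerivAt (fun s : ℝ => Real.exp (c * s) • NormedSpace.exp (s • x))
      ((x + c • (1 : 𝔸)) * (Real.exp (c * s) • NormedSpace.exp (s • x))) s := by
    intro s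
    have h1 : HasDerivAt (fun s : ℝ => Real.exp (c * s)) (Real.exp (c * s) * c) s := by
      simpa using ((hasDerivAt_id s).const_mul c).exp
    refine (h1.smul (hasDerivAt_exp_smul_const' (𝕂 := ℝ) x s)).congr_deriv ?_
    rw [add_mul, mul_smul_comm, smul_mul_assoc, one_mul, smul_smul, mul_comm c (Real.exp _)]
  have h := norm_le_gronwallBound_of_norm_deriv_right_le
    (f := fun s : ℝ => Real.exp (c * s) • NormedSpace.exp (s • x))
    (f' := fun s => (x + c • (1 : 𝔸)) * (Real.exp (c * s) • NormedSpace.exp (s • x)))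
    (δ := 1) (K := ‖x + c • (1 : 𝔸)‖) (ε := 0) (a := 0) (b := τ)
    (fun s _ => (hd s).continuousAt.continuousWithinAt)
    (fun s _ => (hd s).hasDerivWithinAt)
    (by simp [NormedSpace.exp_zero]) (fun s _ => by rw [add_zero]; exact norm_mul_le _ _)
    τ ⟨hτ, le_rfl⟩
  rw [gronwallBound_ε0, sub_zero, one_mul, norm_smul, Real.norm_eq_abs, Real.abs_exp,
    ← le_div_iff₀' (Real.exp_pos _), ← Real.exp_sub, ← sub_mul] at h
  exact h

theorem IsIrreducibleGenerator.exists_shift_nonneg {n : ℕ} {Q : Matrix (Fin n) (Fin n) ℝ}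
    (hQ : IsIrreducibleGenerator Q) : ∃ c : ℝ, 0 ≤ c ∧
      (∀ a b, 0 ≤ (Q + c • (1 : Matrix (Fin n) (Fin n) ℝ)) a b) ∧
      ∀ a, ∑ b, (Q + c • (1 : Matrix (Fin n) (Fin n) ℝ)) a b = c := by
  -- Uniformization: any c above all |Q k k| makes Q + c nonnegative.
  refine ⟨∑ k, |Q k k|, Finset.sum_nonneg fun _ _ => abs_nonneg _, fun a b => ?_, fun a => ?_⟩
  · by_cases hab : a = b
    · subst hab
      have h1 : |Q a a| ≤ ∑ k, |Q k k| :=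
        Finset.single_le_sum (f := fun k => |Q k k|) (fun _ _ => abs_nonneg _)
          (Finset.mem_univ a)
      have h2 := neg_abs_le (Q a a)
      rw [Matrix.add_apply, Matrix.smul_apply, Matrix.one_apply_eq, smul_eq_mul, mul_one]
      linarith
    · simpa [Matrix.one_apply_ne hab] using hQ.offDiag_nonneg a b hab
  · simp [Finset.sum_add_distrib, hQ.row_sum a, Matrix.one_apply]

attribute [local instance] Matrix.linftyOpNormedRing Matrix.linftyOpNormedAlgebra

variable {n : ℕ} {Q : Matrix (Fin n) (Fin n) ℝ}

theorem hasDerivAt_exp_smul_mulVec (G : Matrix (Fin n) (Fin n) ℝ) (g : Fin n → ℝ) (j : Fin n)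
    (u : ℝ) : HasDerivAt (fun u : ℝ => (NormedSpace.exp (u • G)).mulVec g j)
      ((NormedSpace.exp (u • G)).mulVec (G.mulVec g) j) u := by
  let L : Matrix (Fin n) (Fin n) ℝ →ₗ[ℝ] ℝ :=
    { toFun := fun M => M.mulVec g j
      map_add' := fun M N => by simp [Matrix.add_mulVec]
      map_smul' := fun c M => by simp [Matrix.smul_mulVec] }
  have h := (LinearMap.toContinuousLinearMap L).hasFDerivAt.comp_hasDerivAt u
    (hasDerivAt_exp_smul_const (𝕂 := ℝ) G u)
  refine h.congr_deriv ?_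
  rw [Matrix.mulVec_mulVec]
  rfl

theorem linfty_opNorm_le_of_nonneg {M : Matrix (Fin n) (Fin n) ℝ} {c : ℝ} (hc : 0 ≤ c)
    (hM : ∀ a b, 0 ≤ M a b) (hrow : ∀ a, ∑ b, M a b = c) : ‖M‖ ≤ c := by
  lift c to NNReal using hc
  rw [Matrix.linfty_opNorm_def, NNReal.coe_le_coe]
  refine Finset.sup_le fun a _ => NNReal.coe_le_coe.1 (le_of_eq ?_)
  rw [NNReal.coe_sum, ← hrow a]
  exact Finset.sum_congr rfl fun b _ => Real.norm_of_nonneg (hM a b)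

/-- In the maximal row sum norm the shifted generator has norm at most c, so the exponent in
`norm_exp_smul_le` is nonpositive. `NeZero n` ensures that the identity matrix has norm one. -/
theorem IsIrreducibleGenerator.norm_exp_le [NeZero n] (hQ : IsIrreducibleGenerator Q) {τ : ℝ}
    (hτ : 0 ≤ τ) : ‖NormedSpace.exp (τ • Q)‖ ≤ 1 := by
  obtain ⟨c, hc, hnn, hrow⟩ := hQ.exists_shift_nonneg
  refine (norm_exp_smul_le Q c hτ).trans (Real.exp_le_one_iff.2 ?_)
  exact mul_nonpos_of_nonpos_of_nonneg
    (sub_nonpos.2 (linfty_opNorm_le_of_nonneg hc hnn hrow)) hτ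

/-- The transition matrices of a generator are contractions for the supremum norm. -/
theorem IsIrreducibleGenerator.norm_exp_mulVec_le (hQ : IsIrreducibleGenerator Q) {τ : ℝ}
    (hτ : 0 ≤ τ) (g : Fin n → ℝ) (j : Fin n) :
    |(NormedSpace.exp (τ • Q)).mulVec g j| ≤ ‖g‖ := by
  have : NeZero n := ⟨by rintro rfl; exact j.elim0⟩
  refine (norm_le_pi_norm _ j).trans ((Matrix.linfty_opNorm_mulVec _ g).trans ?_)
  exact mul_le_of_le_one_left (norm_nonneg _) (hQ.norm_exp_le hτ)

/-- Maximum principle: harmonic functions of an irreducible generator are constant. -/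
theorem IsIrreducibleGenerator.eq_of_mulVec_eq_zero (hQ : IsIrreducibleGenerator Q)
    {g : Fin n → ℝ} (hg : Q.mulVec g = 0) (a b : Fin n) : g a = g b := by
  have : Nonempty (Fin n) := ⟨a⟩
  obtain ⟨m, hm⟩ := Finite.exists_max g
  have step : ∀ x y, g x = g m → 0 < Q x y → g y = g m := by
    intro x y hx hxy
    -- At a maximum point x every term of this sum is nonnegative, so each vanishes and g is maximal
    -- at all states reachable in one jump.
    have h0 : ∑ k, Q x k * (g m - g k) = 0 := by
      have h1 : ∑ k, Q x k * g k = 0 := congrFun hg x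
      simp [mul_sub, Finset.sum_sub_distrib, ← Finset.sum_mul, hQ.row_sum x, h1]
    have h2 := (Finset.sum_eq_zero_iff_of_nonneg (fun k _ => by
      by_cases hk : x = k
      · subst hk; simp [hx]
      · exact mul_nonneg (hQ.offDiag_nonneg x k hk) (sub_nonneg.2 (hm k)))).1 h0 y
        (Finset.mem_univ y)
    rcases mul_eq_zero.1 h2 with h | h
    · exact absurd h hxy.ne'
    · linarith
  have all : ∀ y, g y = g m := fun y => by
    induction hQ.irreducible m y with
    | refl => rfl
    | tail _ hxy ih => exact step _ _ ih hxy
  rw [all a, all b]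

/-- The Poisson equation `Q g = f` is solvable for every `f` of mean zero. -/
theorem IsIrreducibleGenerator.exists_mulVec_eq (hQ : IsIrreducibleGenerator Q) {p : Fin n → ℝ}
    (hp : IsInvariantProbability Q p) {f : Fin n → ℝ} (hf : ∑ j, p j * f j = 0) :
    ∃ g, Q.mulVec g = f := by
  have hpQ : ∀ g : Fin n → ℝ, ∑ j, p j * Q.mulVec g j = 0 := by
    intro g
    have := Matrix.dotProduct_mulVec p Q g
    rw [hp.vecMul_eq_zero, zero_dotProduct] at this
    exact this
  -- Adding the p-mean to Q removes the kernel of constants. Since p Q = 0, pairing L g with p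
  -- returns the mean of g, so L g = 0 forces g to be harmonic of mean zero, hence zero.
  let L : (Fin n → ℝ) →ₗ[ℝ] (Fin n → ℝ) :=
    { toFun := fun g j => Q.mulVec g j + ∑ k, p k * g k
      map_add' := fun g h => by
        ext j; simp [Matrix.mulVec_add, mul_add, Finset.sum_add_distrib]; ring
      map_smul' := fun c g => by
        ext j; simp [Matrix.mulVec_smul, mul_add, Finset.mul_sum]
        exact Finset.sum_congr rfl fun _ _ => by ring }
  have hL : ∀ g, ∑ j, p j * L g j = ∑ k, p k * g k := by
    intro g
    change ∑ j, p j * (Q.mulVec g j + ∑ k, p k * g k) = _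
    simp only [mul_add, Finset.sum_add_distrib, hpQ g, ← Finset.sum_mul, hp.sum_eq_one]
    simp
  have hinj : Function.Injective L := by
    refine (injective_iff_map_eq_zero L).2 fun g hg => ?_
    have h1 : ∑ k, p k * g k = 0 := by rw [← hL g, hg]; simp
    have h2 : Q.mulVec g = 0 := by
      ext j
      have h3 : Q.mulVec g j + ∑ k, p k * g k = 0 := congrFun hg j
      simpa [h1] using h3
    ext j
    have h4 : ∑ k, p k * g k = g j := by
      simp only [hQ.eq_of_mulVec_eq_zero h2 _ j, ← Finset.sum_mul, hp.sum_eq_one, one_mul]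
    rw [← h4, h1]; rfl
  obtain ⟨g, hg⟩ := (LinearMap.injective_iff_surjective.1 hinj) f
  refine ⟨g, ?_⟩
  have h1 : ∑ k, p k * g k = 0 := by rw [← hL g, hg, hf]
  ext j
  have h3 : Q.mulVec g j + ∑ k, p k * g k = f j := congrFun hg j
  simpa [h1] using h3

/-- Applied to G g, the semigroup is an exact time derivative, so its integral over a window of any
length is a difference of boundary values. This replaces decay of correlations. -/
theorem integral_exp_mulVec (G : Matrix (Fin n) (Fin n) ℝ) (g : Fin n → ℝ) (j : Fin n)
    (u s : ℝ) : ∫ v in u..s, (NormedSpace.exp ((v - u) • G)).mulVec (G.mulVec g) j =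
      (NormedSpace.exp ((s - u) • G)).mulVec g j - g j := by
  have hc : Continuous fun v : ℝ => (NormedSpace.exp (v • G)).mulVec (G.mulVec g) j :=
    continuous_iff_continuousAt.2 fun v =>
      (hasDerivAt_exp_smul_mulVec G (G.mulVec g) j v).continuousAt
  have hc' : Continuous fun v : ℝ => (NormedSpace.exp ((v - u) • G)).mulVec (G.mulVec g) j :=
    hc.comp (continuous_id.sub continuous_const)
  rw [intervalIntegral.integral_eq_sub_of_hasDerivAt
    (f := fun v => (NormedSpace.exp ((v - u) • G)).mulVec g j)
    (fun v _ => by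
      simpa using (hasDerivAt_exp_smul_mulVec G g j (v - u)).comp_sub_const v u)
    (hc'.intervalIntegrable _ _)]
  simp [NormedSpace.exp_zero]

end Generator

theorem IsIrreducibleGenerator.smul {n : ℕ} {Q : Matrix (Fin n) (Fin n) ℝ}
    (hQ : IsIrreducibleGenerator Q) {r : ℝ} (hr : 0 < r) : IsIrreducibleGenerator (r • Q) where
  offDiag_nonneg i j hij := mul_nonneg hr.le (hQ.offDiag_nonneg i j hij)
  row_sum i := by simp [← Finset.mul_sum, hQ.row_sum i]
  irreducible i j := Relation.ReflTransGen.mono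
    (fun _ _ h => mul_pos hr h) i j (hQ.irreducible i j)

/-! ### Joint measurability and Fubini. -/

section Measurability

variable {n d : ℕ} {A : Fin n → Matrix (Fin d) (Fin d) ℝ} {Ω : Type*} [MeasurableSpace Ω]
  {P : Measure Ω} {I : ℝ → Ω → Fin n}

/-- The process is sampled at the grid point (⌊(N+1)s⌋ + 1)/(N+1), which lies to the right of s; the
added 1 matters because paths converge only from the right. -/
theorem measurable_process (hm : ∀ t, 0 ≤ t → Measurable (I t))
    (hI : ∀ ω t, 0 ≤ t → ContinuousWithinAt (fun s => I s ω) (Ici t) t) :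
    Measurable (fun z : ℝ × Ω => I (max z.1 0) z.2) := by
  have key : ∀ N : ℕ, Measurable (fun z : ℝ × Ω =>
      I (((⌊((N : ℝ) + 1) * max z.1 0⌋₊ : ℝ) + 1) / ((N : ℝ) + 1)) z.2) := by
    intro N
    have h1 : Measurable (fun z : ℝ × Ω => (⌊((N : ℝ) + 1) * max z.1 0⌋₊, z.2)) :=
      (Nat.measurable_floor.comp (by fun_prop)).prodMk measurable_snd
    have h2 : Measurable (fun q : ℕ × Ω => I (((q.1 : ℝ) + 1) / ((N : ℝ) + 1)) q.2) :=
      measurable_from_prod_countable_right fun k =>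
        hm (((k : ℝ) + 1) / ((N : ℝ) + 1)) (by positivity)
    exact h2.comp h1
  refine measurable_of_tendsto_metrizable key ?_
  rw [tendsto_pi_nhds]
  rintro ⟨s, ω⟩
  have hs : (0 : ℝ) ≤ max s 0 := le_max_right _ _
  refine (hI ω _ hs).tendsto.comp (tendsto_nhdsWithin_iff.2 ⟨?_, ?_⟩)
  · have hlim : Tendsto (fun N : ℕ => max s 0 + 1 / ((N : ℝ) + 1)) atTop (𝓝 (max s 0)) := by
      simpa using tendsto_const_nhds.add (tendsto_one_div_add_atTop_nhds_zero_nat (𝕜 := ℝ))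
    refine tendsto_of_tendsto_of_tendsto_of_le_of_le tendsto_const_nhds hlim ?_ ?_
    · intro N
      have hN : (0 : ℝ) < (N : ℝ) + 1 := by positivity
      have := (Nat.lt_floor_add_one (((N : ℝ) + 1) * max s 0)).le
      simp only
      rw [le_div_iff₀ hN]
      linarith
    · intro N
      have hN : (0 : ℝ) < (N : ℝ) + 1 := by positivity
      have := Nat.floor_le (mul_nonneg hN.le hs)
      simp only
      have e : (max s 0 + 1 / ((N : ℝ) + 1)) * ((N : ℝ) + 1) = ((N : ℝ) + 1) * max s 0 + 1 := by
        field_simp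
      rw [div_le_iff₀ hN, e]
      linarith
  · refine Eventually.of_forall fun N => ?_
    have hN : (0 : ℝ) < (N : ℝ) + 1 := by positivity
    have := (Nat.lt_floor_add_one (((N : ℝ) + 1) * max s 0)).le
    rw [mem_Ici, le_div_iff₀ hN]
    linarith

theorem measurable_process_apply (hm : ∀ t, 0 ≤ t → Measurable (I t)) (s : ℝ) :
    Measurable (I (max s 0)) := hm _ (le_max_right _ _)

theorem stronglyMeasurable_intervalIntegral {V : Type*} [NormedAddCommGroup V] [NormedSpace ℝ V]
    {F : ℝ → Ω → V} (hF : StronglyMeasurable (Function.uncurry F)) (a b : ℝ) :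
    StronglyMeasurable fun ω => ∫ u in a..b, F u ω :=
  hF.integral_prod_left.sub hF.integral_prod_left

theorem integral_intervalIntegral_swap_of_bound [IsFiniteMeasure P] {F : ℝ → Ω → ℝ}
    (hF : StronglyMeasurable (Function.uncurry F)) {a b : ℝ} (hab : a ≤ b) {C : ℝ}
    (hC : ∀ u ∈ Ioc a b, ∀ ω, |F u ω| ≤ C) :
    ∫ ω, (∫ u in a..b, F u ω) ∂P = ∫ u in a..b, (∫ ω, F u ω ∂P) := by
  simp only [intervalIntegral.integral_of_le hab]
  refine (integral_integral_swap ?_).symm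
  refine Integrable.of_bound hF.aestronglyMeasurable C ?_
  have h : ∀ᵐ z ∂(volume.restrict (Ioc a b)).prod P, z.1 ∈ Ioc a b :=
    Measure.quasiMeasurePreserving_fst.ae (ae_restrict_mem measurableSet_Ioc)
  filter_upwards [h] with z hz
  exact hC z.1 hz z.2

theorem stronglyMeasurable_pathIntegral (f : Fin n → ℝ) (hm : ∀ t, 0 ≤ t → Measurable (I t))
    (hI : ∀ ω t, 0 ≤ t → ContinuousWithinAt (fun s => I s ω) (Ici t) t) :
    StronglyMeasurable (Function.uncurry fun s ω => pathIntegral f (fun u => I u ω) s) :=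
  stronglyMeasurable_uncurry_of_continuous_of_stronglyMeasurable
    (fun ω => continuous_pathIntegral f (hI ω))
    fun s => stronglyMeasurable_intervalIntegral (F := fun u ω => f (I (max u 0) ω))
      ((measurable_of_finite f).comp (measurable_process hm hI)).stronglyMeasurable 0 s

theorem stronglyMeasurable_fluctuationBound (p : Fin n → ℝ)
    (hm : ∀ t, 0 ≤ t → Measurable (I t))
    (hI : ∀ ω t, 0 ≤ t → ContinuousWithinAt (fun s => I s ω) (Ici t) t) :
    StronglyMeasurable (Function.uncurry fun s ω => fluctuationBound A p (fun u => I u ω) s) := by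
  have h := Finset.stronglyMeasurable_fun_sum Finset.univ fun j _ =>
    (stronglyMeasurable_pathIntegral (fun k => (if k = j then 1 else 0) - p j) hm hI).norm.mul
      (stronglyMeasurable_const (b := ‖op (A j)‖))
  exact h

/-- The induction integrates over time, so it needs joint measurability; this follows from
continuity in time and measurability in ω at each fixed time. -/
theorem stronglyMeasurable_picardTerm (hm : ∀ t, 0 ≤ t → Measurable (I t))
    (hI : ∀ ω t, 0 ≤ t → ContinuousWithinAt (fun s => I s ω) (Ici t) t) (k : ℕ) (t : ℝ) :
    StronglyMeasurable fun ω => picardTerm A (fun s => I s ω) k t := by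
  induction k generalizing t with
  | zero => exact stronglyMeasurable_const
  | succ k ih =>
    have h1 : StronglyMeasurable
        (Function.uncurry fun s ω => picardTerm A (fun u => I u ω) k s) :=
      stronglyMeasurable_uncurry_of_continuous_of_stronglyMeasurable
        (fun ω => continuous_picardTerm (hI ω) k) ih
    have h2 : StronglyMeasurable (Function.uncurry fun s ω => coeff A (fun u => I u ω) s) :=
      ((measurable_of_finite (fun j : Fin n => op (A j))).comp
        (measurable_process hm hI)).stronglyMeasurable
    exact stronglyMeasurable_intervalIntegral (h2.mul h1) 0 t

theorem stronglyMeasurable_solutionOperator (hm : ∀ t, 0 ≤ t → Measurable (I t))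
    (hI : ∀ ω t, 0 ≤ t → ContinuousWithinAt (fun s => I s ω) (Ici t) t) {t : ℝ} (ht : 0 ≤ t) :
    StronglyMeasurable fun ω => solutionOperator A (fun s => I s ω) t :=
  stronglyMeasurable_of_tendsto atTop
    (fun N => Finset.stronglyMeasurable_fun_sum (Finset.range N) fun k _ =>
      stronglyMeasurable_picardTerm (A := A) hm hI k t)
    (tendsto_pi_nhds.2 fun ω => tendsto_picardSum (hI ω) ht)

theorem integrable_solutionOperator [IsFiniteMeasure P] (hm : ∀ t, 0 ≤ t → Measurable (I t))
    (hI : ∀ ω t, 0 ≤ t → ContinuousWithinAt (fun s => I s ω) (Ici t) t) {t : ℝ} (ht : 0 ≤ t) :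
    Integrable (fun ω => solutionOperator A (fun s => I s ω) t) P :=
  Integrable.of_bound (stronglyMeasurable_solutionOperator hm hI ht).aestronglyMeasurable
    (Real.exp ((∑ j, ‖op (A j)‖) * t)) (Eventually.of_forall fun ω => by
      rw [← solutionOperatorExt_of_nonneg ht]
      exact norm_solutionOperatorExt_le (hI ω) ht)

end Measurability

/-! ### Moments of additive functionals of the Markov process. -/

section Moments

variable {n d : ℕ} {A : Fin n → Matrix (Fin d) (Fin d) ℝ} {Ω : Type*} [MeasurableSpace Ω]
  {P : Measure Ω} [IsProbabilityMeasure P] {I : ℝ → Ω → Fin n} {G : Matrix (Fin n) (Fin n) ℝ}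
  {ν : Measure (Fin n)}

theorem sum_measureReal_inter_fiber {X : Ω → Fin n} (hX : Measurable X) (s : Set Ω) :
    ∑ k, P.real {ω | X ω = k ∧ ω ∈ s} = P.real s := by
  have h := sum_measureReal_preimage_singleton (μ := P.restrict s) (Finset.univ : Finset (Fin n))
    (f := X) (fun y _ => hX (measurableSet_singleton y))
  simp only [Finset.coe_univ, preimage_univ, measureReal_restrict_apply_univ] at h
  rw [← h]
  refine Finset.sum_congr rfl fun k _ => ?_
  rw [measureReal_restrict_apply (hX (measurableSet_singleton k))]
  rfl

/-- The finite-dimensional laws are anchored at time 0, so the initial state is summed out; the laws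
at (0, u) and (0, u, v) differ by one transition factor. -/
theorem IsMarkovProcess.two_times (hI : IsMarkovProcess P I G ν) {u v : ℝ} (hu : 0 ≤ u)
    (huv : u ≤ v) (a b : Fin n) :
    P.real {ω | I u ω = a ∧ I v ω = b} =
      P.real {ω | I u ω = a} * (NormedSpace.exp ((v - u) • G)) a b := by
  rw [← sum_measureReal_inter_fiber (hI.measurable 0 le_rfl) {ω | I u ω = a ∧ I v ω = b},
    ← sum_measureReal_inter_fiber (hI.measurable 0 le_rfl) {ω | I u ω = a}, Finset.sum_mul]
  refine Finset.sum_congr rfl fun k _ => ?_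
  have h1 := hI.finite_dim 1 ![0, u] ![k, a] rfl (by
    refine Fin.monotone_iff_le_succ.2 fun j => ?_
    fin_cases j; simpa using hu)
  have h2 := hI.finite_dim 2 ![0, u, v] ![k, a, b] rfl (by
    refine Fin.monotone_iff_le_succ.2 fun j => ?_
    fin_cases j
    · simpa using hu
    · simpa using huv)
  simp [Fin.forall_fin_succ, Fin.prod_univ_succ] at h1 h2
  simp only [mem_ofPred_eq]
  rw [h1, h2, mul_assoc]

/-- The Markov property, E[g(I_v) | I_u] = (exp((v - u)G) g)(I_u), in integrated form without
conditional expectations. -/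
theorem IsMarkovProcess.integral_mul (hI : IsMarkovProcess P I G ν) {u v : ℝ} (hu : 0 ≤ u)
    (huv : u ≤ v) (f g : Fin n → ℝ) :
    ∫ ω, f (I u ω) * g (I v ω) ∂P =
      ∑ a, P.real {ω | I u ω = a} * (f a * (NormedSpace.exp ((v - u) • G)).mulVec g a) := by
  have hm : Measurable fun ω => (I u ω, I v ω) :=
    (hI.measurable u hu).prodMk (hI.measurable v (hu.trans huv))
  have h := integral_map (μ := P) hm.aemeasurable
    (f := fun z : Fin n × Fin n => f z.1 * g z.2)
    (measurable_of_finite _).aestronglyMeasurable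
  have : IsProbabilityMeasure (P.map fun ω => (I u ω, I v ω)) :=
    Measure.isProbabilityMeasure_map hm.aemeasurable
  rw [← h, integral_fintype Integrable.of_finite, Fintype.sum_prod_type]
  refine Finset.sum_congr rfl fun a _ => ?_
  simp only [Matrix.mulVec, dotProduct, Finset.mul_sum]
  refine Finset.sum_congr rfl fun b _ => ?_
  rw [map_measureReal_apply hm (measurableSet_singleton _)]
  have e : (fun ω => (I u ω, I v ω)) ⁻¹' {(a, b)} = {ω | I u ω = a ∧ I v ω = b} := by
    ext ω; simp
  rw [e, hI.two_times hu huv, smul_eq_mul]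
  ring

/-- The correlation of the present with the future of an additive functional is controlled by
the solution of the Poisson equation. -/
theorem IsMarkovProcess.abs_integral_mul_le (hI : IsMarkovProcess P I G ν)
    (hrc : ∀ ω t, 0 ≤ t → ContinuousWithinAt (fun s => I s ω) (Ici t) t)
    (hG : IsIrreducibleGenerator G) (g : Fin n → ℝ) {u s : ℝ} (hu : 0 ≤ u) (hus : u ≤ s) :
    |∫ ω, G.mulVec g (I (max u 0) ω) * (∫ v in u..s, G.mulVec g (I (max v 0) ω)) ∂P| ≤
      (∑ k, |G.mulVec g k|) * (2 * ‖g‖) := by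
  set f := G.mulVec g with hf
  set F := ∑ k, |f k| with hF
  have hF0 : 0 ≤ F := Finset.sum_nonneg fun _ _ => abs_nonneg _
  have hmeas : Measurable fun z : ℝ × Ω => f (I (max z.1 0) z.2) :=
    (measurable_of_finite f).comp (measurable_process hI.measurable hrc)
  have hmu : Measurable fun z : ℝ × Ω => f (I (max u 0) z.2) :=
    ((measurable_of_finite f).comp (measurable_process_apply hI.measurable u)).comp measurable_snd
  have e1 : ∫ ω, f (I (max u 0) ω) * (∫ v in u..s, f (I (max v 0) ω)) ∂P =
      ∫ v in u..s, ∑ a, P.real {ω | I u ω = a} *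
        (f a * (NormedSpace.exp ((v - u) • G)).mulVec f a) := by
    simp only [← intervalIntegral.integral_const_mul]
    rw [integral_intervalIntegral_swap_of_bound (C := F * F) (hmu.mul hmeas).stronglyMeasurable
      hus (fun v _ ω => by
        rw [abs_mul]
        exact mul_le_mul (abs_le_sum_abs f _) (abs_le_sum_abs f _) (abs_nonneg _) hF0)]
    refine intervalIntegral.integral_congr fun v hv => ?_
    rw [uIcc_of_le hus] at hv
    simp only [max_eq_left hu, max_eq_left (hu.trans hv.1)]
    exact hI.integral_mul hu hv.1 f f
  have hc : ∀ a, Continuous fun v : ℝ => (NormedSpace.exp ((v - u) • G)).mulVec f a := fun a =>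
    (continuous_iff_continuousAt.2 fun v =>
      (hasDerivAt_exp_smul_mulVec G f a v).continuousAt).comp
        (continuous_id.sub continuous_const)
  have hc' : ∀ a, Continuous fun v : ℝ =>
      P.real {ω | I u ω = a} * (f a * (NormedSpace.exp ((v - u) • G)).mulVec f a) := fun a =>
    continuous_const.mul (continuous_const.mul (hc a))
  rw [e1, intervalIntegral.integral_finsetSum fun a _ => (hc' a).intervalIntegrable _ _]
  -- Because f = G g, the time integral collapses to (exp((s - u)G) g - g)(a), at most 2‖g‖ in
  -- absolute value by contractivity.
  simp only [intervalIntegral.integral_const_mul, hf, integral_exp_mulVec]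
  rw [← hf]
  refine (Finset.abs_sum_le_sum_abs _ _).trans ?_
  have hP1 : ∑ a, P.real {ω | I u ω = a} = 1 := by
    have := sum_measureReal_inter_fiber (P := P) (hI.measurable u hu) univ
    simpa using this
  rw [← one_mul (F * (2 * ‖g‖)), ← hP1, Finset.sum_mul]
  refine Finset.sum_le_sum fun a _ => ?_
  rw [abs_mul, abs_mul, abs_of_nonneg measureReal_nonneg]
  refine mul_le_mul_of_nonneg_left ?_ measureReal_nonneg
  refine mul_le_mul (abs_le_sum_abs f a) ?_ (abs_nonneg _) hF0
  refine (abs_sub _ _).trans ?_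
  have h1 := hG.norm_exp_mulVec_le (sub_nonneg.2 hus) g a
  have h2 : |g a| ≤ ‖g‖ := norm_le_pi_norm g a
  linarith

/-- Each u in the formula `sq_pathIntegral` contributes a bounded correlation, so the second moment
grows only linearly in s. -/
theorem IsMarkovProcess.integral_sq_pathIntegral_le (hI : IsMarkovProcess P I G ν)
    (hrc : ∀ ω t, 0 ≤ t → ContinuousWithinAt (fun s => I s ω) (Ici t) t)
    (hG : IsIrreducibleGenerator G) (g : Fin n → ℝ) {s : ℝ} (hs : 0 ≤ s) :
    ∫ ω, pathIntegral (G.mulVec g) (fun u => I u ω) s ^ 2 ∂P ≤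
      4 * (∑ k, |G.mulVec g k|) * ‖g‖ * s := by
  set f := G.mulVec g with hf
  set F := ∑ k, |f k| with hF
  have hF0 : 0 ≤ F := Finset.sum_nonneg fun _ _ => abs_nonneg _
  have hmeas : Measurable fun z : ℝ × Ω => f (I (max z.1 0) z.2) :=
    (measurable_of_finite f).comp (measurable_process hI.measurable hrc)
  have hZ := stronglyMeasurable_pathIntegral f hI.measurable hrc
  have e : ∀ u ω, ∫ v in u..s, f (I (max v 0) ω) =
      pathIntegral f (fun u => I u ω) s - pathIntegral f (fun u => I u ω) u := fun u ω =>
    (intervalIntegral.integral_interval_sub_left (intervalIntegrable_comp_path f (hrc ω) _ _)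
      (intervalIntegrable_comp_path f (hrc ω) _ _)).symm
  have hjoint : StronglyMeasurable (Function.uncurry fun (u : ℝ) ω =>
      2 * (f (I (max u 0) ω) * ∫ v in u..s, f (I (max v 0) ω))) := by
    simp only [e]
    have h1 : StronglyMeasurable fun z : ℝ × Ω => pathIntegral f (fun u => I u z.2) s :=
      hZ.comp_measurable (measurable_const.prodMk measurable_snd)
    exact (hmeas.stronglyMeasurable.mul (h1.sub hZ)).const_mul 2
  have hbd : ∀ u ∈ Ioc (0 : ℝ) s, ∀ ω,
      |2 * (f (I (max u 0) ω) * ∫ v in u..s, f (I (max v 0) ω))| ≤ 2 * (F * (F * s)) := by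
    intro u hu ω
    rw [abs_mul, abs_mul, abs_two]
    have h1 : |∫ v in u..s, f (I (max v 0) ω)| ≤ F * |s - u| :=
      intervalIntegral.norm_integral_le_of_norm_le_const
        (f := fun v => f (I (max v 0) ω)) fun v _ => abs_le_sum_abs f _
    rw [abs_of_nonneg (sub_nonneg.2 hu.2)] at h1
    have h2 : F * (s - u) ≤ F * s := mul_le_mul_of_nonneg_left (by linarith [hu.1]) hF0
    exact mul_le_mul_of_nonneg_left
      (mul_le_mul (abs_le_sum_abs f _) (h1.trans h2) (abs_nonneg _) hF0) zero_le_two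
  simp only [fun ω => sq_pathIntegral f (hrc ω) hs]
  rw [integral_intervalIntegral_swap_of_bound hjoint hs hbd]
  have h := intervalIntegral.norm_integral_le_of_norm_le_const (a := 0) (b := s)
    (f := fun u => ∫ ω, 2 * (f (I (max u 0) ω) * ∫ v in u..s, f (I (max v 0) ω)) ∂P)
    (C := 2 * (F * (2 * ‖g‖))) (fun u hu => by
      rw [uIoc_of_le hs] at hu
      rw [integral_const_mul, Real.norm_eq_abs, abs_mul, abs_two]
      exact mul_le_mul_of_nonneg_left (hI.abs_integral_mul_le hrc hG g hu.1.le hu.2) zero_le_two)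
  refine (le_abs_self _).trans (h.trans (le_of_eq ?_))
  rw [sub_zero, abs_of_nonneg hs]
  ring

/-- For the generator r Q the same f has Poisson solution g / r, which puts a factor 1/r into the
second moment. -/
theorem IsMarkovProcess.integral_abs_pathIntegral_le {Q : Matrix (Fin n) (Fin n) ℝ}
    (hQ : IsIrreducibleGenerator Q) (g : Fin n → ℝ) {r : ℝ} (hr : 0 < r)
    (hI : IsMarkovProcess P I (r • Q) ν)
    (hrc : ∀ ω t, 0 ≤ t → ContinuousWithinAt (fun s => I s ω) (Ici t) t) {s : ℝ} (hs : 0 ≤ s) :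
    ∫ ω, |pathIntegral (Q.mulVec g) (fun u => I u ω) s| ∂P ≤
      (1 + 4 * (∑ k, |Q.mulVec g k|) * ‖g‖ * s) / √r := by
  set f := Q.mulVec g with hf
  set F := ∑ k, |f k| with hF
  have hF0 : 0 ≤ F := Finset.sum_nonneg fun _ _ => abs_nonneg _
  have hfg : (r • Q).mulVec (r⁻¹ • g) = f := by
    rw [Matrix.mulVec_smul, Matrix.smul_mulVec, smul_smul, inv_mul_cancel₀ hr.ne', one_smul]
  have hsq := hI.integral_sq_pathIntegral_le hrc (hQ.smul hr) (r⁻¹ • g) hs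
  rw [hfg, norm_smul, norm_inv, Real.norm_of_nonneg hr.le] at hsq
  have hZm : StronglyMeasurable fun ω => pathIntegral f (fun u => I u ω) s :=
    (stronglyMeasurable_pathIntegral f hI.measurable hrc).comp_measurable
      (measurable_const.prodMk measurable_id)
  have hZb : ∀ ω, |pathIntegral f (fun u => I u ω) s| ≤ F * s := fun ω =>
    abs_pathIntegral_le f _ hs
  have hZ2 : Integrable (fun ω => pathIntegral f (fun u => I u ω) s ^ 2) P :=
    Integrable.of_bound (hZm.pow 2).aestronglyMeasurable ((F * s) ^ 2)
      (Eventually.of_forall fun ω => by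
        rw [norm_pow]
        exact pow_le_pow_left₀ (abs_nonneg _) (hZb ω) 2)
  have hZ1 : Integrable (fun ω => |pathIntegral f (fun u => I u ω) s|) P :=
    Integrable.of_bound hZm.norm.aestronglyMeasurable (F * s)
      (Eventually.of_forall fun ω => by rw [Real.norm_eq_abs, abs_abs]; exact hZb ω)
  have hq : 0 < √r := Real.sqrt_pos.2 hr
  have hqq : √r * √r = r := Real.mul_self_sqrt hr.le
  have hmono : ∫ ω, |pathIntegral f (fun u => I u ω) s| ∂P ≤
      ∫ ω, ((√r)⁻¹ + √r * pathIntegral f (fun u => I u ω) s ^ 2) ∂P := by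
    refine integral_mono hZ1 ((integrable_const _).add (hZ2.const_mul _)) fun ω => ?_
    set z := pathIntegral f (fun u => I u ω) s
    have h1 : √r * (√r)⁻¹ = 1 := mul_inv_cancel₀ hq.ne'
    -- Young's inequality weighted by √r: as E z² is O(1/r), both terms of (√r)⁻¹ + √r z² have mean
    -- of order 1/√r.
    have h2 : 0 ≤ √r * (|z| - (√r)⁻¹) ^ 2 := by positivity
    have h3 : √r * (|z| - (√r)⁻¹) ^ 2 = √r * z ^ 2 - 2 * |z| + (√r)⁻¹ := by
      rw [sub_sq, sq_abs]
      linear_combination (-2 * |z| + (√r)⁻¹) * h1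
    have h4 := abs_nonneg z
    change |z| ≤ (√r)⁻¹ + √r * z ^ 2
    linarith
  rw [integral_add (integrable_const _) (hZ2.const_mul _), integral_const_mul] at hmono
  simp only [integral_const, probReal_univ, one_smul] at hmono
  refine hmono.trans ?_
  refine (add_le_add le_rfl (mul_le_mul_of_nonneg_left hsq hq.le)).trans (le_of_eq ?_)
  have : r⁻¹ = (√r)⁻¹ * (√r)⁻¹ := by rw [← mul_inv, hqq]
  rw [this]
  field_simp
  rw [hF]
  ring

/-- The constant precedes the probability space, the initial law and the rate, since the probability
space may change with r. -/
theorem IsMarkovProcess.exists_integral_abs_pathIntegral_le {Q : Matrix (Fin n) (Fin n) ℝ}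
    (hQ : IsIrreducibleGenerator Q) {p : Fin n → ℝ} (hp : IsInvariantProbability Q p)
    {f : Fin n → ℝ} (hf : ∑ j, p j * f j = 0) (t : ℝ) :
    ∃ C, ∀ {Ω : Type*} [MeasurableSpace Ω] {P : Measure Ω} [IsProbabilityMeasure P]
      {I : ℝ → Ω → Fin n} {ν : Measure (Fin n)} {r : ℝ}, 0 < r →
      IsMarkovProcess P I (r • Q) ν →
      (∀ ω t, 0 ≤ t → ContinuousWithinAt (fun s => I s ω) (Ici t) t) → ∀ s ∈ Icc 0 t,
      ∫ ω, |pathIntegral f (fun u => I u ω) s| ∂P ≤ C / √r := by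
  obtain ⟨g, rfl⟩ := hQ.exists_mulVec_eq hp hf
  refine ⟨1 + 4 * (∑ k, |Q.mulVec g k|) * ‖g‖ * t, fun hr hI hrc s hs => ?_⟩
  refine (hI.integral_abs_pathIntegral_le hQ g hr hrc hs.1).trans ?_
  have : 0 ≤ ∑ k, |Q.mulVec g k| := Finset.sum_nonneg fun _ _ => abs_nonneg _
  have := hs.2
  gcongr

end Moments

/-! ### Regular versions and the averaging estimate. -/

theorem sum_invariant_mul_indicator_sub {n : ℕ} {Q : Matrix (Fin n) (Fin n) ℝ} {p : Fin n → ℝ}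
    (hp : IsInvariantProbability Q p) (j : Fin n) :
    ∑ k, p k * ((if k = j then 1 else 0) - p j) = 0 := by
  simp [mul_sub, Finset.sum_sub_distrib, ← Finset.sum_mul, hp.sum_eq_one]

/-- Every Markov process on a finite set has an indistinguishable version all of whose paths are
right-continuous. -/
theorem IsMarkovProcess.exists_rightContinuous {n : ℕ} {Ω : Type*} [MeasurableSpace Ω]
    {P : Measure Ω} [IsProbabilityMeasure P] {I : ℝ → Ω → Fin n} {G : Matrix (Fin n) (Fin n) ℝ}
    {ν : Measure (Fin n)} (hI : IsMarkovProcess P I G ν) :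
    ∃ J : ℝ → Ω → Fin n, IsMarkovProcess P J G ν ∧
      (∀ ω t, 0 ≤ t → ContinuousWithinAt (fun s => J s ω) (Ici t) t) ∧
      ∀ᵐ ω ∂P, ∀ t, J t ω = I t ω := by
  classical
  obtain ⟨ω₀⟩ : Nonempty Ω := nonempty_of_isProbabilityMeasure P
  obtain ⟨N, hN, hNm, hN0⟩ := exists_measurable_superset_of_null (ae_iff.1 hI.right_continuous)
  -- On a measurable null set containing the bad paths, the path is replaced by a constant one. The
  -- set is the same for all times, so functionals of the whole path agree almost surely.
  let J : ℝ → Ω → Fin n := fun t => N.piecewise (fun _ => I 0 ω₀) (I t)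
  have hJI : ∀ᵐ ω ∂P, ∀ t, J t ω = I t ω := by
    filter_upwards [measure_eq_zero_iff_ae_notMem.1 hN0] with ω hω t
    exact piecewise_eq_of_notMem _ _ _ hω
  have hJ : ∀ ω t, 0 ≤ t → ContinuousWithinAt (fun s => J s ω) (Ici t) t := by
    intro ω
    by_cases hω : ω ∈ N
    · intro t _
      simpa [J, hω] using continuousWithinAt_const
    · have h : ∀ t, 0 ≤ t → ContinuousWithinAt (fun s => I s ω) (Ici t) t := by
        by_contra hcon
        exact hω (hN hcon)
      simpa [J, hω] using h
  refine ⟨J, ⟨fun t ht => measurable_const.piecewise hNm (hI.measurable t ht),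
    Eventually.of_forall hJ, fun m t i h0 hmono => ?_⟩, hJ, hJI⟩
  rw [← hI.finite_dim m t i h0 hmono]
  refine measureReal_congr ?_
  filter_upwards [hJI] with ω hω
  refine propext ?_
  change (∀ k, J (t k) ω = i k) ↔ ∀ k, I (t k) ω = i k
  simp only [hω]

theorem exists_integral_fluctuationBound_le {n d : ℕ} (A : Fin n → Matrix (Fin d) (Fin d) ℝ)
    {Q : Matrix (Fin n) (Fin n) ℝ} (hQ : IsIrreducibleGenerator Q) {p : Fin n → ℝ}
    (hp : IsInvariantProbability Q p) (t : ℝ) :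
    ∃ C, ∀ {Ω : Type*} [MeasurableSpace Ω] {P : Measure Ω} [IsProbabilityMeasure P]
      {I : ℝ → Ω → Fin n} {ν : Measure (Fin n)} {r : ℝ}, 0 < r →
      IsMarkovProcess P I (r • Q) ν →
      (∀ ω t, 0 ≤ t → ContinuousWithinAt (fun s => I s ω) (Ici t) t) → ∀ s ∈ Icc 0 t,
      ∫ ω, fluctuationBound A p (fun u => I u ω) s ∂P ≤ C / √r := by
  choose C hC using fun j => IsMarkovProcess.exists_integral_abs_pathIntegral_le hQ hp
    (sum_invariant_mul_indicator_sub hp j) t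
  refine ⟨∑ j, C j * ‖op (A j)‖, fun {Ω _ P _ I ν r} hr hI hrc s hs => ?_⟩
  simp only [fluctuationBound]
  rw [integral_finsetSum]
  · rw [Finset.sum_div]
    refine Finset.sum_le_sum fun j _ => ?_
    rw [integral_mul_const, mul_div_right_comm]
    exact mul_le_mul_of_nonneg_right (hC j hr hI hrc s hs) (norm_nonneg _)
  · intro j _
    refine Integrable.mul_const ?_ _
    have hm : StronglyMeasurable fun ω =>
        pathIntegral (fun k => (if k = j then 1 else 0) - p j) (fun u => I u ω) s :=
      (stronglyMeasurable_pathIntegral (fun k => (if k = j then 1 else 0) - p j)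
        hI.measurable hrc).comp_measurable (measurable_const.prodMk measurable_id)
    exact Integrable.of_bound hm.norm.aestronglyMeasurable _ (Eventually.of_forall fun ω => by
      rw [Real.norm_eq_abs, abs_abs]
      exact abs_pathIntegral_le _ _ hs.1)

theorem fluctuationBound_le {n d : ℕ} (A : Fin n → Matrix (Fin d) (Fin d) ℝ) (p : Fin n → ℝ)
    (i : ℝ → Fin n) {s t : ℝ} (hs : s ∈ Icc 0 t) :
    fluctuationBound A p i s ≤
      ∑ j, (∑ k, |(if k = j then 1 else 0) - p j|) * t * ‖op (A j)‖ := by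
  refine Finset.sum_le_sum fun j _ => mul_le_mul_of_nonneg_right ?_ (norm_nonneg _)
  exact (abs_pathIntegral_le _ i hs.1).trans
    (mul_le_mul_of_nonneg_left hs.2 (Finset.sum_nonneg fun _ _ => abs_nonneg _))

/-- The averaging principle with a rate. -/
theorem exists_abs_integral_norm_solutionOperator_sub_le {n d : ℕ}
    (A : Fin n → Matrix (Fin d) (Fin d) ℝ) {Q : Matrix (Fin n) (Fin n) ℝ}
    (hQ : IsIrreducibleGenerator Q) {p : Fin n → ℝ} (hp : IsInvariantProbability Q p) {t : ℝ}
    (ht : 0 ≤ t) :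
    ∃ C, ∀ {Ω : Type*} [MeasurableSpace Ω] {P : Measure Ω} [IsProbabilityMeasure P]
      {I : ℝ → Ω → Fin n} {ν : Measure (Fin n)} {r : ℝ}, 0 < r →
      IsMarkovProcess P I (r • Q) ν →
      (∀ ω t, 0 ≤ t → ContinuousWithinAt (fun s => I s ω) (Ici t) t) →
      |∫ ω, ‖solutionOperator A (fun s => I s ω) t‖ ∂P -
        ‖NormedSpace.exp (t • op (averageMatrix A p))‖| ≤ C / √r := by
  obtain ⟨C₁, hC₁0, hC₁⟩ := exists_norm_solutionOperator_sub_exp_le A p ht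
  obtain ⟨C₂, hC₂⟩ := exists_integral_fluctuationBound_le A hQ hp t
  -- C₂ bounds the fluctuation at time t, and C₂ * t its integral over [0, t].
  refine ⟨C₁ * (C₂ + C₂ * t), fun {Ω _ P _ I ν r} hr hI hrc => ?_⟩
  set w : ℝ → Ω → ℝ := fun s ω => fluctuationBound A p (fun u => I u ω) s with hw
  have hwm : StronglyMeasurable (Function.uncurry w) :=
    stronglyMeasurable_fluctuationBound p hI.measurable hrc
  set M := ∑ j, (∑ k, |(if k = j then 1 else 0) - p j|) * t * ‖op (A j)‖
  have hwM : ∀ s ∈ Icc 0 t, ∀ ω, |w s ω| ≤ M := fun s hs ω => by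
    rw [abs_of_nonneg (fluctuationBound_nonneg p s)]
    exact fluctuationBound_le A p _ hs
  have hS := integrable_solutionOperator (A := A) (P := P) hI.measurable hrc ht
  have hi1 : Integrable (w t) P :=
    Integrable.of_bound (hwm.comp_measurable
      (measurable_const.prodMk measurable_id)).aestronglyMeasurable M
      (Eventually.of_forall fun ω => hwM t ⟨ht, le_rfl⟩ ω)
  have hi2 : Integrable (fun ω => ∫ s in (0 : ℝ)..t, w s ω) P :=
    Integrable.of_bound (stronglyMeasurable_intervalIntegral hwm 0 t).aestronglyMeasurable
      (M * |t - 0|) (Eventually.of_forall fun ω =>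
        intervalIntegral.norm_integral_le_of_norm_le_const fun s hs => by
          rw [uIoc_of_le ht] at hs
          exact hwM s ⟨hs.1.le, hs.2⟩ ω)
  set E := NormedSpace.exp (t • op (averageMatrix A p)) with hE
  have h1 : |∫ ω, ‖solutionOperator A (fun s => I s ω) t‖ ∂P - ‖E‖| ≤
      ∫ ω, C₁ * (w t ω + ∫ s in (0 : ℝ)..t, w s ω) ∂P := by
    have e : ∫ ω, ‖solutionOperator A (fun s => I s ω) t‖ ∂P - ‖E‖ =
        ∫ ω, (‖solutionOperator A (fun s => I s ω) t‖ - ‖E‖) ∂P := by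
      rw [integral_sub hS.norm (integrable_const _)]
      simp
    rw [e]
    rw [← Real.norm_eq_abs]
    refine norm_integral_le_of_norm_le ((hi1.add hi2).const_mul C₁)
      (Eventually.of_forall fun ω => ?_)
    exact (abs_norm_sub_norm_le _ _).trans (hC₁ _ (hrc ω))
  refine h1.trans ?_
  rw [integral_const_mul, integral_add hi1 hi2, mul_div_assoc]
  refine mul_le_mul_of_nonneg_left ?_ hC₁0
  rw [add_div]
  refine add_le_add (hC₂ hr hI hrc t ⟨ht, le_rfl⟩) ?_
  rw [integral_intervalIntegral_swap_of_bound hwm ht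
    (fun s hs ω => hwM s ⟨hs.1.le, hs.2⟩ ω)]
  have h2 := intervalIntegral.norm_integral_le_of_norm_le_const (a := 0) (b := t)
    (f := fun s => ∫ ω, w s ω ∂P) (C := C₂ / √r) (fun s hs => by
      rw [uIoc_of_le ht] at hs
      rw [Real.norm_of_nonneg (integral_nonneg fun ω => fluctuationBound_nonneg p s)]
      exact hC₂ hr hI hrc s ⟨hs.1.le, hs.2⟩)
  rw [sub_zero, abs_of_nonneg ht] at h2
  refine (le_abs_self _).trans (h2.trans (le_of_eq ?_))
  ring

end SwitchedODE

/-! ### The limit of fast switching. -/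

theorem mainTheorem9 {n d : ℕ} (A : Fin n → Matrix (Fin d) (Fin d) ℝ)
    (Q : Matrix (Fin n) (Fin n) ℝ) (hQ : SwitchedODE.IsIrreducibleGenerator Q)
    (p : Fin n → ℝ) (hp : SwitchedODE.IsInvariantProbability Q p)
    (ν : MeasureTheory.Measure (Fin n)) [MeasureTheory.IsProbabilityMeasure ν]
    {Ω : ℝ → Type*} [∀ r, MeasurableSpace (Ω r)]
    (P : ∀ r, MeasureTheory.Measure (Ω r)) [∀ r, MeasureTheory.IsProbabilityMeasure (P r)]
    (I : ∀ r, ℝ → Ω r → Fin n)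
    (hI : ∀ r, 0 < r → SwitchedODE.IsMarkovProcess (P r) (I r) (r • Q) ν)
    (t : ℝ) (ht : 0 < t) :
    (∀ r, 0 < r → MeasureTheory.Integrable
      (fun ω => ‖SwitchedODE.solutionOperator A (fun s => I r s ω) t‖) (P r)) ∧
    Filter.Tendsto
      (fun r => ∫ ω, ‖SwitchedODE.solutionOperator A (fun s => I r s ω) t‖ ∂(P r))
      Filter.atTop
      (nhds ‖NormedSpace.exp (t • SwitchedODE.op (SwitchedODE.averageMatrix A p))‖) := by
  obtain ⟨C, hC⟩ := SwitchedODE.exists_abs_integral_norm_solutionOperator_sub_le A hQ hp ht.le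
  -- The estimates require every path to be right-continuous; passing to such a version changes
  -- neither integrability nor the expectation.
  have hJ : ∀ r, 0 < r → ∃ J : ℝ → Ω r → Fin n,
      SwitchedODE.IsMarkovProcess (P r) J (r • Q) ν ∧
      (∀ ω t, 0 ≤ t → ContinuousWithinAt (fun s => J s ω) (Ici t) t) ∧
      (fun ω => ‖SwitchedODE.solutionOperator A (fun s => J s ω) t‖) =ᵐ[P r]
        fun ω => ‖SwitchedODE.solutionOperator A (fun s => I r s ω) t‖ := by
    intro r hr
    obtain ⟨J, h1, h2, h3⟩ := (hI r hr).exists_rightContinuous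
    refine ⟨J, h1, h2, ?_⟩
    filter_upwards [h3] with ω hω
    simp only [hω]
  refine ⟨fun r hr => ?_, ?_⟩
  · obtain ⟨J, h1, h2, h3⟩ := hJ r hr
    exact (SwitchedODE.integrable_solutionOperator h1.measurable h2 ht.le).norm.congr h3
  · rw [tendsto_iff_norm_sub_tendsto_zero]
    have hlim : Tendsto (fun r : ℝ => C / √r) atTop (𝓝 0) :=
      Real.tendsto_sqrt_atTop.const_div_atTop C
    refine squeeze_zero' (Eventually.of_forall fun _ => norm_nonneg _) ?_ hlim
    filter_upwards [eventually_gt_atTop 0] with r hr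
    obtain ⟨J, h1, h2, h3⟩ := hJ r hr
    rw [← integral_congr_ae h3]
    exact hC hr h1 h2
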